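/- For a convex polytope $P \subset \mathbb{R}^N$ (the convex hull of a finite set of points) and an integer $k \ge 0$, let $\mathcal{G}_k(P)$ be the simple graph whose nodes are the $k$-dimensional faces of $P$, two distinct such faces being adjacent if some $(k+1)$-dimensional face of $P$ contains them both. For a positive integer $m$, a graph is called $m$-connected if it has at least $m+1$ nodes and every graph obtained from it by deleting at most $m-1$ nodes (with their incident edges) is connected. Two polytopes are called polar-dual if there is an inclusion-reversing bijection (an anti-isomorphism) between their sets of faces, the empty face and the polytope itself included. A prism over a simplex $\Delta$ is a Minkowski sum $\Delta + [0,u]$, where $u$ is a vector not parallel to the affine hull of $\Delta$. Let $d \ge 2$ be an integer. Then: (1) for every $d$-dimensional convex polytope $P$, the graph $\mathcal{G}_{d-2}(P)$ is $d$-connected; (2) there exist $d$-dimensional convex polytopes $P$ for which $\mathcal{G}_{d-2}(P)$ is not $(d+1)$-connected. More precisely, there exist $d$-dimensional convex polytopes that are polar-dual to a prism over a $(d-1)$-dimensional simplex, and for every such polytope $P$ the graph $\mathcal{G}_{d-2}(P)$ is not $(d+1)$-connected. -/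

import Mathlib

/-- A convex polytope: the convex hull of a finite set of points. -/
def IsConvexPolytope {E : Type*} [AddCommGroup E] [Module ℝ E] (P : Set E) : Prop :=
  ∃ s : Set E, s.Finite ∧ P = convexHull ℝ s

/-- The set `S` is nonempty and its affine hull has dimension `k`. (The empty set has dimension
`-1` by convention, so it never satisfies this.) -/
def HasAffineDim {E : Type*} [AddCommGroup E] [Module ℝ E] (S : Set E) (k : ℕ) : Prop :=
  S.Nonempty ∧ Module.finrank ℝ (affineSpan ℝ S).direction = k

/-- The face lattice of `P`: the faces of `P`, ordered by inclusion. A face of `P` is either empty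
or the set of all points of `P` at which some linear functional attains its maximum over `P`
(equivalently, replacing the functional by its negative, its minimum). -/
abbrev FaceLattice {E : Type*} [AddCommGroup E] [Module ℝ E] [TopologicalSpace E]
    (P : Set E) : Type _ :=
  {F : Set E // IsExposed ℝ P F}

/-- The faces of `P` of dimension `k`. -/
abbrev FaceOfDim {E : Type*} [AddCommGroup E] [Module ℝ E] [TopologicalSpace E]
    (P : Set E) (k : ℕ) : Type _ :=
  {F : Set E // IsExposed ℝ P F ∧ HasAffineDim F k}

/-- The graph `𝒢_k(P)`: its nodes are the `k`-dimensional faces of `P`, and two distinct such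
faces are adjacent if some `(k + 1)`-dimensional face of `P` contains them both. -/
def faceGraph {E : Type*} [AddCommGroup E] [Module ℝ E] [TopologicalSpace E]
    (P : Set E) (k : ℕ) : SimpleGraph (FaceOfDim P k) where
  Adj F G := F ≠ G ∧ ∃ H : FaceOfDim P (k + 1), F.1 ⊆ H.1 ∧ G.1 ⊆ H.1
  symm := ⟨fun _ _ ⟨hne, H, hF, hG⟩ => ⟨hne.symm, H, hG, hF⟩⟩
  loopless := ⟨fun _ h => h.1 rfl⟩

/-- For `m ≥ 1`, a graph is `m`-(vertex-)connected if it has at least `m + 1` nodes and deleting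
any set of at most `m - 1` nodes leaves a connected graph. -/
def IsVertexConnected {V : Type*} (G : SimpleGraph V) (m : ℕ) : Prop :=
  (m : ℕ∞) + 1 ≤ ENat.card V ∧
    ∀ S : Finset V, S.card < m → (G.induce ((S : Set V)ᶜ)).Connected

/-- `P` and `Q` are polar-dual (to be used for polytopes): there is an inclusion-reversing
bijection, with inclusion-reversing inverse, between the faces of `P` and those of `Q`. -/
def IsPolarDual {E E' : Type*} [AddCommGroup E] [Module ℝ E] [TopologicalSpace E]
    [AddCommGroup E'] [Module ℝ E'] [TopologicalSpace E'] (P : Set E) (Q : Set E') : Prop :=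
  Nonempty (FaceLattice P ≃o (FaceLattice Q)ᵒᵈ)

open scoped Pointwise in
/-- `Q` is a prism over an `n`-dimensional simplex: the Minkowski sum `Δ + [0, u]` of an
`n`-simplex `Δ` and a line segment whose direction `u` is not parallel to the affine hull
of `Δ`. -/
def IsPrismOverSimplex {E : Type*} [AddCommGroup E] [Module ℝ E] (Q : Set E) (n : ℕ) : Prop :=
  ∃ (Δ : Affine.Simplex ℝ E n) (u : E),
    u ∉ (affineSpan ℝ (Set.range Δ.points)).direction ∧
      Q = convexHull ℝ (Set.range Δ.points) + segment ℝ 0 u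

/-- `P` is polar-dual to some prism over an `n`-dimensional simplex. -/
def IsDualOfSimplexPrism {E : Type*} [AddCommGroup E] [Module ℝ E] [TopologicalSpace E]
    (P : Set E) (n : ℕ) : Prop :=
  ∃ (M : ℕ) (Q : Set (EuclideanSpace ℝ (Fin M))), IsPrismOverSimplex Q n ∧ IsPolarDual P Q

/-! A polytope is replaced by the space `L` of restrictions of affine functions to a finite point
family spanning it. Faces become zero sets of nonnegative members of `L`, and for a `d`-polytope the
corank of a face is `d` minus its dimension: facets have corank 1, ridges corank 2, the empty face
corank `d + 1`.

Connectivity. Suppose deleting fewer than `d` ridges separates two remaining ones. Call a facet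
reached if it contains a ridge reachable from the first. A ridge lying in both a reached and an
unreached facet must have been deleted, since otherwise reachability would pass through it. It
therefore suffices that a partition of the facets into two nonempty classes has at least `d`
crossing ridges. This is `corank_le_card_crossing` at the empty face, proved by induction over faces
`G`: given two crossing ridges `R ≠ R'` through `G`, pass to a face `K` covering `G` with `K ⊆ R`
and `K ⊄ R'`; the induction hypothesis counts the crossings through `K`, and `R'` is one more. The
crossings themselves come from linear programming on the dual polytope, whose vertices are the
normalised facet normals: a vertex with no better neighbour is optimal
(`IsZeroFacet.exists_adjacent_lt`), so the best facet of one class, if not optimal overall, has a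
neighbour in the other class.

Sharpness. For a dual of the prism over an `n`-simplex, with `d = n + 1`, ridges are edges of the
prism, and adjacent ridges are edges with a common vertex. Removing the at most `d` ridges dual to
vertical edges separates the edges of the two bases. A bipyramid over a simplex is such a dual,
because its vertex-facet incidences are those of the prism transposed. -/

set_option linter.unusedSectionVars false

/-! ### Faces as zero sets of nonnegative functions in a finite-dimensional space. -/

section FunctionFaces

variable {ι : Type*} [Fintype ι]

/-- The functions of `L` vanishing on `S`. -/
def vanishing (L : Submodule ℝ (ι → ℝ)) (S : Finset ι) : Submodule ℝ (ι → ℝ) where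
  carrier := {f | f ∈ L ∧ ∀ i ∈ S, f i = 0}
  add_mem' := fun ha hb => ⟨L.add_mem ha.1 hb.1, fun i hi => by simp [ha.2 i hi, hb.2 i hi]⟩
  zero_mem' := ⟨L.zero_mem, fun _ _ => rfl⟩
  smul_mem' := fun c _ ha => ⟨L.smul_mem c ha.1, fun i hi => by simp [ha.2 i hi]⟩

/-- The dimension of the space of functions of `L` vanishing on `S`. -/
noncomputable def corank (L : Submodule ℝ (ι → ℝ)) (S : Finset ι) : ℕ :=
  Module.finrank ℝ (vanishing L S)

/-- `S` is the zero set of a nonnegative function of `L`. -/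
def IsZeroFace (L : Submodule ℝ (ι → ℝ)) (S : Finset ι) : Prop :=
  ∃ f ∈ L, (∀ i, 0 ≤ f i) ∧ ∀ i, f i = 0 ↔ i ∈ S

/-- A zero face of corank one. -/
def IsZeroFacet (L : Submodule ℝ (ι → ℝ)) (S : Finset ι) : Prop :=
  IsZeroFace L S ∧ corank L S = 1

variable {L : Submodule ℝ (ι → ℝ)} {S T F F' G H R : Finset ι}

theorem vanishing_anti (h : S ⊆ T) : vanishing L T ≤ vanishing L S :=
  fun _ hf => ⟨hf.1, fun i hi => hf.2 i (h hi)⟩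

theorem corank_anti (h : S ⊆ T) : corank L T ≤ corank L S :=
  Submodule.finrank_mono (vanishing_anti h)

theorem IsZeroFace.corank_lt (hS : IsZeroFace L S) (h : S ⊂ T) : corank L T < corank L S := by
  obtain ⟨f, hf, -, hz⟩ := hS
  obtain ⟨i, hiT, hiS⟩ := Finset.exists_of_ssubset h
  refine Submodule.finrank_lt_finrank_of_lt (lt_of_le_of_ne (vanishing_anti h.1) fun he => ?_)
  have : f ∈ vanishing L T := he ▸ ⟨hf, fun j hj => (hz j).2 hj⟩
  exact hiS ((hz i).1 (this.2 i hiT))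

theorem IsZeroFace.eq_of_subset (hS : IsZeroFace L S) (h : S ⊆ T)
    (hc : corank L S ≤ corank L T) : S = T := by
  by_contra hne
  exact absurd (hS.corank_lt (Finset.ssubset_iff_subset_ne.2 ⟨h, hne⟩)) (by omega)

theorem corank_univ : corank L Finset.univ = 0 := by
  have : vanishing L Finset.univ = ⊥ := by
    rw [eq_bot_iff]
    intro f hf
    simpa [funext_iff] using hf.2
  simp [corank, this]

theorem IsZeroFace.eq_univ (hS : IsZeroFace L S) (h : corank L S = 0) : S = Finset.univ :=
  hS.eq_of_subset (Finset.subset_univ _) (by omega)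

theorem isZeroFace_univ : IsZeroFace L Finset.univ :=
  ⟨0, L.zero_mem, fun _ => le_rfl, fun _ => by simp⟩

theorem IsZeroFace.inter [DecidableEq ι] (hS : IsZeroFace L S) (hT : IsZeroFace L T) :
    IsZeroFace L (S ∩ T) := by
  obtain ⟨f, hf, f0, fz⟩ := hS
  obtain ⟨g, hg, g0, gz⟩ := hT
  refine ⟨f + g, L.add_mem hf hg, fun i => add_nonneg (f0 i) (g0 i), fun i => ?_⟩
  rw [Pi.add_apply, add_eq_zero_iff_of_nonneg (f0 i) (g0 i), fz, gz, Finset.mem_inter]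

/-- The zero set, inside a face, of a function that is nonnegative on the face, is a face. -/
theorem IsZeroFace.filter_zero (hH : IsZeroFace L H) {k : ι → ℝ} (hk : k ∈ L)
    (k0 : ∀ i ∈ H, 0 ≤ k i) : IsZeroFace L {i ∈ H | k i = 0} := by
  obtain ⟨h, hh, h0, hz⟩ := hH
  -- A large multiple of the function defining `H` makes `k` positive off `H` without changing it on
  -- `H`.
  obtain ⟨t, ht⟩ : ∃ t : ℝ, ∀ i, i ∉ H → 0 < k i + t * h i := by
    have : ∀ i, ∀ᶠ t : ℝ in Filter.atTop, i ∉ H → 0 < k i + t * h i := by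
      intro i
      by_cases hi : i ∈ H
      · simp [hi]
      · have hpos : 0 < h i := lt_of_le_of_ne (h0 i) fun e => hi ((hz i).1 e.symm)
        filter_upwards [Filter.eventually_gt_atTop (-k i / h i)] with t ht _
        rw [div_lt_iff₀ hpos] at ht
        linarith
    exact (Filter.eventually_all.2 this).exists
  refine ⟨k + t • h, L.add_mem hk (L.smul_mem t hh), fun i => ?_, fun i => ?_⟩
  · by_cases hi : i ∈ H
    · simpa [(hz i).2 hi] using k0 i hi
    · exact (ht i hi).le
  · by_cases hi : i ∈ H
    · simp [(hz i).2 hi, hi]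
    · simpa [hi] using (ht i hi).ne'

theorem exists_max_ratio {s : Finset ι} (hs : s.Nonempty) {h : ι → ℝ} (hh : ∀ i ∈ s, 0 < h i)
    (u : ι → ℝ) : ∃ t : ℝ, (∀ i ∈ s, u i ≤ t * h i) ∧ ∃ i ∈ s, u i = t * h i := by
  obtain ⟨i, hi, hmax⟩ := s.exists_max_image (fun i => u i / h i) hs
  refine ⟨u i / h i, fun j hj => ?_, i, hi, (div_mul_cancel₀ _ (hh i hi).ne').symm⟩
  exact (div_le_iff₀ (hh j hj)).1 (hmax j hj)

/-- Between two nested faces whose coranks differ by at least two there is another face. -/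
theorem IsZeroFace.exists_between (hG : IsZeroFace L G) (hH : IsZeroFace L H) (hGH : G ⊂ H)
    (hc : corank L H + 2 ≤ corank L G) : ∃ K, IsZeroFace L K ∧ G ⊂ K ∧ K ⊂ H := by
  classical
  obtain ⟨h, hh, h0, hz⟩ := hG
  -- The corank gap of two leaves a direction `u` that on `H` is not a multiple of `h`.
  obtain ⟨u, huG, hu⟩ : ∃ u ∈ vanishing L G, u ∉ vanishing L H ⊔ Submodule.span ℝ {h} := by
    by_contra! hcon
    have h1 : corank L G ≤ Module.finrank ℝ
        (vanishing L H ⊔ Submodule.span ℝ {h} : Submodule ℝ (ι → ℝ)) :=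
      Submodule.finrank_mono hcon
    have h2 := Submodule.finrank_add_le_finrank_add_finrank (vanishing L H) (Submodule.span ℝ {h})
    have h3 := finrank_span_le_card (R := ℝ) ({h} : Set (ι → ℝ))
    simp only [Set.toFinset_singleton, Finset.card_singleton] at h3
    have : Module.finrank ℝ (vanishing L H) = corank L H := rfl
    omega
  have hpos : ∀ i ∈ H \ G, 0 < h i := fun i hi =>
    lt_of_le_of_ne (h0 i) fun e => (Finset.mem_sdiff.1 hi).2 ((hz i).1 e.symm)
  -- With `t` the largest ratio `u / h` on `H \ G`, the function `t • h - u` is nonnegative on `H`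
  -- and gains a zero at `v`; the choice of `u` prevents it from vanishing on all of `H`.
  obtain ⟨t, ht, v, hv, hvt⟩ := exists_max_ratio (Finset.sdiff_nonempty.2 hGH.2) hpos u
  rw [Finset.mem_sdiff] at hv
  have hkL : t • h - u ∈ L := L.sub_mem (L.smul_mem t hh) huG.1
  refine ⟨{i ∈ H | (t • h - u) i = 0}, hH.filter_zero hkL fun i hi => ?_, ?_, ?_⟩
  · by_cases hiG : i ∈ G
    · simp [huG.2 i hiG, (hz i).2 hiG]
    · simpa using ht i (Finset.mem_sdiff.2 ⟨hi, hiG⟩)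
  · refine (Finset.ssubset_iff_of_subset fun i hi => ?_).2 ⟨v, ?_, hv.2⟩
    · simp [hGH.1 hi, huG.2 i hi, (hz i).2 hi]
    · simp [hv.1, hvt]
  · refine Finset.filter_ssubset.2 ?_
    by_contra! hcon
    refine hu ?_
    have h1 : t • h - u ∈ vanishing L H := ⟨hkL, hcon⟩
    have h2 : u = -(t • h - u) + t • h := by abel
    rw [h2]
    exact Submodule.add_mem_sup (Submodule.neg_mem _ h1)
      (Submodule.smul_mem _ _ (Submodule.mem_span_singleton_self h))

theorem IsZeroFace.exists_cover (hG : IsZeroFace L G) (hH : IsZeroFace L H) (hGH : G ⊂ H) :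
    ∃ K, IsZeroFace L K ∧ G ⊂ K ∧ K ⊆ H ∧ corank L K + 1 = corank L G := by
  classical
  obtain ⟨K, hK, hmin⟩ := Finset.exists_min_image
    {K : Finset ι | IsZeroFace L K ∧ G ⊂ K ∧ K ⊆ H} Finset.card ⟨H, by simp [hH, hGH]⟩
  simp only [Finset.mem_filter, Finset.mem_univ, true_and] at hK hmin
  refine ⟨K, hK.1, hK.2.1, hK.2.2, ?_⟩
  have h1 := hG.corank_lt hK.2.1
  by_contra hne
  obtain ⟨K', hK', h2, h3⟩ := hG.exists_between hK.1 hK.2.1 (by omega)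
  exact absurd (hmin K' ⟨hK', h2, h3.1.trans hK.2.2⟩) (not_le.2 (Finset.card_lt_card h3))

theorem IsZeroFace.exists_cocover (hG : IsZeroFace L G) (hH : IsZeroFace L H) (hGH : G ⊂ H) :
    ∃ K, IsZeroFace L K ∧ G ⊆ K ∧ K ⊂ H ∧ corank L K = corank L H + 1 := by
  classical
  obtain ⟨K, hK, hmax⟩ := Finset.exists_max_image
    {K : Finset ι | IsZeroFace L K ∧ G ⊆ K ∧ K ⊂ H} Finset.card ⟨G, by simp [hG, hGH]⟩
  simp only [Finset.mem_filter, Finset.mem_univ, true_and] at hK hmax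
  refine ⟨K, hK.1, hK.2.1, hK.2.2, ?_⟩
  have h1 := hK.1.corank_lt hK.2.2
  by_contra hne
  obtain ⟨K', hK', h2, h3⟩ := hK.1.exists_between hH hK.2.2 (by omega)
  exact absurd (hmax K' ⟨hK', hK.2.1.trans h2.1, h3⟩) (not_le.2 (Finset.card_lt_card h2))

/-- A face properly containing `G`, contained in `R`, but meeting `R'` only in `G`, of corank one
less than that of `G`. -/
theorem IsZeroFace.exists_cover_not_subset {R' : Finset ι} (hG : IsZeroFace L G)
    (hR : IsZeroFace L R) (hR' : IsZeroFace L R') (hGR : G ⊆ R) (hGR' : G ⊆ R')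
    (hRR' : ¬ R ⊆ R') :
    ∃ K, IsZeroFace L K ∧ G ⊂ K ∧ K ⊆ R ∧ ¬ K ⊆ R' ∧ corank L K + 1 = corank L G := by
  classical
  have hG' := hG
  obtain ⟨h, hh, h0, hz⟩ := hG
  obtain ⟨f, hf, f0, fz⟩ := hR'
  obtain ⟨w, hwR, hwR'⟩ := Finset.not_subset.1 hRR'
  have hpos : ∀ i ∈ R \ G, 0 < h i := fun i hi =>
    lt_of_le_of_ne (h0 i) fun e => (Finset.mem_sdiff.1 hi).2 ((hz i).1 e.symm)
  have hwG : w ∈ R \ G := Finset.mem_sdiff.2 ⟨hwR, fun h => hwR' (hGR' h)⟩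
  -- The zeros of `t • h - f` in `R` outside `G` are the points maximising `f / h`. Since `t > 0`,
  -- these satisfy `f > 0` and so avoid `R'`.
  obtain ⟨t, ht, v, hv, hvt⟩ := exists_max_ratio ⟨w, hwG⟩ hpos f
  rw [Finset.mem_sdiff] at hv
  have htpos : 0 < t := by
    have h1 : 0 < f w := lt_of_le_of_ne (f0 w) fun e => hwR' ((fz w).1 e.symm)
    exact pos_of_mul_pos_left (h1.trans_le (ht w hwG)) (h0 w)
  have hkL : t • h - f ∈ L := L.sub_mem (L.smul_mem t hh) hf
  have hK : IsZeroFace L {i ∈ R | (t • h - f) i = 0} := hR.filter_zero hkL fun i hi => by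
    by_cases hiG : i ∈ G
    · simp [(fz i).2 (hGR' hiG), (hz i).2 hiG]
    · simpa using ht i (Finset.mem_sdiff.2 ⟨hi, hiG⟩)
  have hGK : G ⊂ {i ∈ R | (t • h - f) i = 0} := by
    refine (Finset.ssubset_iff_of_subset fun i hi => ?_).2 ⟨v, ?_, hv.2⟩
    · simp [hGR hi, (fz i).2 (hGR' hi), (hz i).2 hi]
    · simp [hv.1, hvt]
  obtain ⟨K', hK', h1, h2, h3⟩ := hG'.exists_cover hK hGK
  refine ⟨K', hK', h1, h2.trans (Finset.filter_subset _ _), fun hcon => h1.2 fun i hi => ?_, h3⟩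
  have h4 := (Finset.mem_filter.1 (h2 hi)).2
  simp only [Pi.sub_apply, Pi.smul_apply, (fz i).2 (hcon hi), smul_eq_mul, sub_zero,
    mul_eq_zero, htpos.ne', false_or] at h4
  exact (hz i).1 h4

/-- A face of corank two in a facet lies in a second facet. -/
theorem IsZeroFace.exists_other_facet (hR : IsZeroFace L R) (hc : corank L R = 2)
    (hF : IsZeroFacet L F) (hRF : R ⊆ F) : ∃ F', IsZeroFacet L F' ∧ R ⊆ F' ∧ ¬ F ⊆ F' := by
  classical
  have hR' := hR
  obtain ⟨h, hh, h0, hz⟩ := hR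
  obtain ⟨⟨f, hf, f0, fz⟩, hFc⟩ := hF
  have hpos : ∀ i ∈ Fᶜ, 0 < f i := fun i hi =>
    lt_of_le_of_ne (f0 i) fun e => (Finset.mem_compl.1 hi) ((fz i).1 e.symm)
  have hne : (Fᶜ).Nonempty := by
    rw [Finset.nonempty_iff_ne_empty, Ne, Finset.compl_eq_empty_iff]
    rintro rfl
    rw [corank_univ] at hFc
    omega
  -- The supporting function `h` of `R` is rotated about `R` by adding multiples of `f` until it
  -- first acquires a zero `v` off `F`; on `F` it stays equal to `h`.
  obtain ⟨t, ht, v, hv, hvt⟩ := exists_max_ratio hne hpos (-h)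
  have hkL : h + t • f ∈ L := L.add_mem hh (L.smul_mem t hf)
  have hZ := (isZeroFace_univ (L := L)).filter_zero hkL fun i _ => by
    by_cases hi : i ∈ F
    · simpa [(fz i).2 hi] using h0 i
    · have := ht i (Finset.mem_compl.2 hi)
      simp only [Pi.neg_apply] at this
      simp only [Pi.add_apply, Pi.smul_apply, smul_eq_mul]
      linarith
  have hvz : (h + t • f) v = 0 := by
    simp only [Pi.neg_apply] at hvt
    simp only [Pi.add_apply, Pi.smul_apply, smul_eq_mul]
    linarith
  have hRss : R ⊂ F := Finset.ssubset_iff_subset_ne.2 ⟨hRF, by rintro rfl; omega⟩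
  obtain ⟨w, hwF, hwR⟩ := Finset.exists_of_ssubset hRss
  have hwZ : (h + t • f) w ≠ 0 := by
    simpa [(fz w).2 hwF] using fun e => hwR ((hz w).1 e)
  have hRZ : R ⊂ ({i | (h + t • f) i = 0} : Finset ι) := by
    refine (Finset.ssubset_iff_of_subset fun i hi => ?_).2 ⟨v, ?_, fun hvR => ?_⟩
    · simp [(hz i).2 hi, (fz i).2 (hRF hi)]
    · simpa using hvz
    · exact (Finset.mem_compl.1 hv) (hRF hvR)
  have h1 := hR'.corank_lt hRZ
  refine ⟨_, ⟨hZ, ?_⟩, hRZ.1, fun hcon => hwZ (by simpa using hcon hwF)⟩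
  by_contra hcon
  have h2 := hZ.eq_univ (by omega)
  have : w ∈ ({i | (h + t • f) i = 0} : Finset ι) := by rw [h2]; exact Finset.mem_univ w
  exact hwZ (by simpa using this)

/-- A face is separated by a facet from any point outside it. -/
theorem IsZeroFace.exists_facet_notMem (hG : IsZeroFace L G) {i : ι} (hi : i ∉ G) :
    ∃ F, IsZeroFacet L F ∧ G ⊆ F ∧ i ∉ F := by
  classical
  obtain ⟨H, hH, hmax⟩ := Finset.exists_max_image
    {K : Finset ι | IsZeroFace L K ∧ G ⊆ K ∧ i ∉ K} Finset.card ⟨G, by simp [hG, hi]⟩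
  simp only [Finset.mem_filter, Finset.mem_univ, true_and] at hH hmax
  obtain ⟨hHf, hGH, hiH⟩ := hH
  refine ⟨H, ⟨hHf, ?_⟩, hGH, hiH⟩
  have hc0 : corank L H ≠ 0 := fun h => hiH (hHf.eq_univ h ▸ Finset.mem_univ i)
  by_contra hc1
  have hHf' := hHf
  obtain ⟨h, hh, h0, hz⟩ := hHf
  have hhi : 0 < h i := lt_of_le_of_ne (h0 i) fun e => hiH ((hz i).1 e.symm)
  -- If the maximal `H` had corank at least two, `h` could be tilted in a direction `u'` that
  -- vanishes at `i`: this creates a new zero while keeping `i` outside, contradicting maximality.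
  obtain ⟨u, huH, hu⟩ : ∃ u ∈ vanishing L H, u ∉ Submodule.span ℝ {h} := by
    by_contra! hcon
    have h1 : corank L H ≤ Module.finrank ℝ (Submodule.span ℝ {h}) :=
      Submodule.finrank_mono hcon
    have h3 := finrank_span_le_card (R := ℝ) ({h} : Set (ι → ℝ))
    simp only [Set.toFinset_singleton, Finset.card_singleton] at h3
    omega
  obtain ⟨u', hu'H, hu'i, j, hj⟩ : ∃ u' ∈ vanishing L H, u' i = 0 ∧ ∃ j, 0 < u' j := by
    have hmem : u - (u i / h i) • h ∈ vanishing L H :=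
      sub_mem huH (Submodule.smul_mem _ _ ⟨hh, fun j hj => (hz j).2 hj⟩)
    have hne : u - (u i / h i) • h ≠ 0 := fun e => hu <| by
      rw [sub_eq_zero.1 e]
      exact Submodule.smul_mem _ _ (Submodule.mem_span_singleton_self h)
    have hi0 : (u - (u i / h i) • h) i = 0 := by simp [hhi.ne']
    obtain ⟨j, hj⟩ := Function.ne_iff.1 hne
    rcases lt_or_gt_of_ne hj with hj | hj
    · exact ⟨-(u - (u i / h i) • h), neg_mem hmem, by rw [Pi.neg_apply, hi0, neg_zero], j,
        by rw [Pi.neg_apply]; exact neg_pos.2 hj⟩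
    · exact ⟨_, hmem, hi0, j, hj⟩
  obtain ⟨t, ht, v, hv, hvt⟩ := exists_max_ratio (s := {j | 0 < u' j}) ⟨j, by simpa using hj⟩
    (h := u') (fun i hi => by simpa using hi) (-h)
  simp only [Finset.mem_filter, Finset.mem_univ, true_and, Pi.neg_apply] at ht hv hvt
  have htn : t ≤ 0 := by
    by_contra! hcon
    have := mul_pos hcon hv
    linarith [h0 v]
  have hkL : h + t • u' ∈ L := L.add_mem hh (L.smul_mem t hu'H.1)
  have hZ := (isZeroFace_univ (L := L)).filter_zero hkL fun i _ => by
    simp only [Pi.add_apply, Pi.smul_apply, smul_eq_mul]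
    rcases lt_or_ge 0 (u' i) with hi | hi
    · linarith [ht i hi]
    · linarith [mul_nonneg_of_nonpos_of_nonpos htn hi, h0 i]
  have hHZ : H ⊂ ({i | (h + t • u') i = 0} : Finset ι) := by
    refine (Finset.ssubset_iff_of_subset fun i hi => ?_).2 ⟨v, ?_, fun hvR => ?_⟩
    · simp [(hz i).2 hi, hu'H.2 i hi]
    · simp only [Finset.mem_filter, Finset.mem_univ, true_and, Pi.add_apply, Pi.smul_apply,
        smul_eq_mul]
      linarith
    · exact hv.ne' (hu'H.2 v hvR)
  refine absurd (hmax _ ⟨hZ, hGH.trans hHZ.1, ?_⟩) (not_le.2 (Finset.card_lt_card hHZ))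
  simp [hu'i, hhi.ne']

theorem IsZeroFace.subset_facet (hG : IsZeroFace L G) (hG' : corank L G ≠ 0) :
    ∃ F, IsZeroFacet L F ∧ G ⊆ F := by
  have : G ≠ Finset.univ := by rintro rfl; exact hG' corank_univ
  obtain ⟨i, hi⟩ : ∃ i, i ∉ G := by simpa [Finset.eq_univ_iff_forall] using this
  obtain ⟨F, hF, h, -⟩ := hG.exists_facet_notMem hi
  exact ⟨F, hF, h⟩

/-! ### Normalised facet normals and linear programming over them. -/

theorem IsZeroFacet.eq_of_subset (hF : IsZeroFacet L F) (hF' : IsZeroFacet L F') (h : F ⊆ F') :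
    F = F' :=
  hF.1.eq_of_subset h (by rw [hF.2, hF'.2])

theorem IsZeroFacet.exists_normal (hF : IsZeroFacet L F) :
    ∃ f ∈ L, (∀ i, 0 ≤ f i) ∧ (∀ i, f i = 0 ↔ i ∈ F) ∧ ∑ i, f i = 1 := by
  obtain ⟨⟨f, hf, f0, fz⟩, hc⟩ := hF
  have hs : 0 < ∑ i, f i := by
    refine lt_of_le_of_ne (Finset.sum_nonneg fun i _ => f0 i) fun e => ?_
    rw [eq_comm, Finset.sum_eq_zero_iff_of_nonneg fun i _ => f0 i] at e
    have : F = Finset.univ := Finset.eq_univ_iff_forall.2 fun i => (fz i).1 (e i (Finset.mem_univ i))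
    rw [this, corank_univ] at hc
    omega
  refine ⟨(∑ i, f i)⁻¹ • f, L.smul_mem _ hf, fun i => mul_nonneg (inv_nonneg.2 hs.le) (f0 i),
    fun i => ?_, ?_⟩
  · simp [hs.ne', fz]
  · simp [← Finset.mul_sum, hs.ne']

open Classical in
/-- The nonnegative function of `L` with zero set the facet `F` and with sum one. -/
noncomputable def facetNormal (L : Submodule ℝ (ι → ℝ)) (F : Finset ι) : ι → ℝ :=
  if h : IsZeroFacet L F then h.exists_normal.choose else 0

theorem IsZeroFacet.normal_spec (hF : IsZeroFacet L F) :
    facetNormal L F ∈ L ∧ (∀ i, 0 ≤ facetNormal L F i) ∧ (∀ i, facetNormal L F i = 0 ↔ i ∈ F) ∧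
      ∑ i, facetNormal L F i = 1 := by
  rw [facetNormal, dif_pos hF]
  exact hF.exists_normal.choose_spec

theorem IsZeroFacet.mem_span (hF : IsZeroFacet L F) {g : ι → ℝ} (hg : g ∈ vanishing L F) :
    ∃ c : ℝ, g = c • facetNormal L F := by
  obtain ⟨h1, h2, h3, h4⟩ := hF.normal_spec
  have hmem : facetNormal L F ∈ vanishing L F := ⟨h1, fun i hi => (h3 i).2 hi⟩
  have hne : (⟨facetNormal L F, hmem⟩ : vanishing L F) ≠ 0 := fun e => by
    have : facetNormal L F = 0 := congrArg Subtype.val e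
    simp [this] at h4
  obtain ⟨c, hc⟩ := (finrank_eq_one_iff_of_nonzero' _ hne).1 hF.2 ⟨g, hg⟩
  exact ⟨c, (congrArg Subtype.val hc).symm⟩

/-- A function that is nonnegative on a facet `F` and vanishes on `G` is a combination of the normal
of `F` and, with nonnegative coefficients, of the normals of the facets through `G` that are
adjacent to `F`; in dual form. -/
theorem IsZeroFacet.nonneg_of_adjacent [DecidableEq ι] (hF : IsZeroFacet L F) (hGF : G ⊆ F)
    (φ : (ι → ℝ) →ₗ[ℝ] ℝ) (hφ : φ (facetNormal L F) = 0)
    (hadj : ∀ F', IsZeroFacet L F' → G ⊆ F' → corank L (F ∩ F') = 2 → 0 ≤ φ (facetNormal L F'))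
    {g : ι → ℝ} (hg : g ∈ vanishing L G) (g0 : ∀ i ∈ F, 0 ≤ g i) : 0 ≤ φ g := by
  -- The induction removes points of `F` at which `g` is nonzero. When none are left, `g` is a
  -- multiple of the normal of `F`, which `φ` kills.
  induction hn : (F.filter fun i => g i ≠ 0).card using Nat.strong_induction_on generalizing g with
  | _ n ih =>
  have hS := hF.1.filter_zero hg.1 g0
  by_cases hSF : {i ∈ F | g i = 0} = F
  · obtain ⟨c, rfl⟩ := hF.mem_span (g := g) ⟨hg.1, fun i hi => by
      rw [← hSF] at hi; exact (Finset.mem_filter.1 hi).2⟩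
    simp [hφ]
  have hSF' : {i ∈ F | g i = 0} ⊂ F :=
    Finset.ssubset_iff_subset_ne.2 ⟨Finset.filter_subset _ _, hSF⟩
  obtain ⟨R, hR, hSR, hRF, hRc⟩ := hS.exists_cocover hF.1 hSF'
  rw [hF.2] at hRc
  obtain ⟨F', hF', hRF', hFF'⟩ := hR.exists_other_facet hRc hF hRF.1
  have hGS : G ⊆ {i ∈ F | g i = 0} := fun i hi => by simp [hGF hi, hg.2 i hi]
  have hc2 : corank L (F ∩ F') = 2 := by
    have h1 := corank_anti (L := L) (Finset.subset_inter hRF.1 hRF')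
    have h2 := (hF.1.inter hF'.1).corank_lt (T := F) (Finset.ssubset_iff_subset_ne.2
      ⟨Finset.inter_subset_left, fun e => hFF' (Finset.inter_eq_left.1 e)⟩)
    rw [hF.2] at h2
    omega
  have hφF' := hadj F' hF' (hGS.trans (hSR.trans hRF')) hc2
  obtain ⟨nL, n0, nz, -⟩ := hF'.normal_spec
  set n' := facetNormal L F'
  have hpos : ∀ i ∈ F \ F', 0 < n' i := fun i hi =>
    lt_of_le_of_ne (n0 i) fun e => (Finset.mem_sdiff.1 hi).2 ((nz i).1 e.symm)
  -- Here `-t ≥ 0` is the largest multiple of `n'` that can be subtracted from `g` while keeping it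
  -- nonnegative on `F`. Old zeros in `F` lie in `R ⊆ F'`, where `n'` vanishes, and `v` is a new
  -- zero.
  obtain ⟨t, ht, v, hv, hvt⟩ := exists_max_ratio (Finset.sdiff_nonempty.2 hFF') hpos (-g)
  have hvpos := hpos v hv
  rw [Finset.mem_sdiff] at hv
  simp only [Pi.neg_apply] at ht hvt
  have htn : t ≤ 0 := by
    by_contra! hcon
    have := mul_pos hcon hvpos
    linarith [g0 v hv.1]
  have hn'G : n' ∈ vanishing L G := ⟨nL, fun i hi => (nz i).2 (hRF' (hSR (hGS hi)))⟩
  have key := ih _ ?_ (g := g + t • n') (add_mem hg (Submodule.smul_mem _ _ hn'G)) ?_ rfl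
  · have : φ g = φ (g + t • n') + (-t) * φ n' := by simp
    rw [this]
    exact add_nonneg key (mul_nonneg (neg_nonneg.2 htn) hφF')
  · rw [← hn]
    refine Finset.card_lt_card ((Finset.ssubset_iff_of_subset fun i hi => ?_).2 ⟨v, ?_, ?_⟩)
    · simp only [Finset.mem_filter] at hi ⊢
      refine ⟨hi.1, fun e => hi.2 ?_⟩
      have : n' i = 0 := (nz i).2 (hRF' (hSR (by simp [hi.1, e])))
      simp [e, this]
    · refine Finset.mem_filter.2 ⟨hv.1, fun e => hv.2 (hRF' (hSR (by simp [hv.1, e])))⟩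
    · have : g v + t * n' v = 0 := by linarith
      simp [this]
  · intro i hi
    simp only [Pi.add_apply, Pi.smul_apply, smul_eq_mul]
    by_cases hiF' : i ∈ F'
    · simpa [(nz i).2 hiF'] using g0 i hi
    · linarith [ht i (Finset.mem_sdiff.2 ⟨hi, hiF'⟩)]

/-- If a facet does not minimise a linear functional among the facets through `G`, then it has an
adjacent facet through `G` with a smaller value. -/
theorem IsZeroFacet.exists_adjacent_lt [DecidableEq ι] (hF : IsZeroFacet L F) (hGF : G ⊆ F)
    {F₁ : Finset ι} (hF₁ : IsZeroFacet L F₁) (hGF₁ : G ⊆ F₁) (κ : (ι → ℝ) →ₗ[ℝ] ℝ)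
    (hlt : κ (facetNormal L F₁) < κ (facetNormal L F)) :
    ∃ F', IsZeroFacet L F' ∧ G ⊆ F' ∧ corank L (F ∩ F') = 2 ∧
      κ (facetNormal L F') < κ (facetNormal L F) := by
  by_contra! hcon
  obtain ⟨h1, h2, h3, h4⟩ := hF₁.normal_spec
  let σ : (ι → ℝ) →ₗ[ℝ] ℝ := ∑ i, LinearMap.proj i
  have hσ : ∀ F, IsZeroFacet L F → σ (facetNormal L F) = 1 := fun F hF => by
    simpa [σ, LinearMap.sum_apply] using hF.normal_spec.2.2.2
  -- All normals have sum one, so subtracting `κ (facetNormal L F) • σ` shifts the values of `κ` on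
  -- them by a constant and makes the value at `F` zero.
  have := hF.nonneg_of_adjacent hGF (κ - κ (facetNormal L F) • σ) (by simp [hσ F hF])
    (fun F' hF' hG' hc => by simpa [hσ F' hF'] using hcon F' hF' hG' hc)
    (g := facetNormal L F₁) ⟨h1, fun i hi => (h3 i).2 (hGF₁ hi)⟩ fun i _ => h2 i
  simp only [LinearMap.sub_apply, LinearMap.smul_apply, hσ F₁ hF₁, smul_eq_mul, mul_one] at this
  linarith

/-- The sum of the values over `S`. -/
noncomputable def sumOn (S : Finset ι) : (ι → ℝ) →ₗ[ℝ] ℝ := ∑ i ∈ S, LinearMap.proj i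

theorem sumOn_apply (S : Finset ι) (f : ι → ℝ) : sumOn S f = ∑ i ∈ S, f i := by
  simp [sumOn, LinearMap.sum_apply]

theorem IsZeroFacet.sumOn_nonneg (hF : IsZeroFacet L F) (S : Finset ι) :
    0 ≤ sumOn S (facetNormal L F) := by
  rw [sumOn_apply]
  exact Finset.sum_nonneg fun i _ => hF.normal_spec.2.1 i

theorem IsZeroFacet.sumOn_le_one (hF : IsZeroFacet L F) (S : Finset ι) :
    sumOn S (facetNormal L F) ≤ 1 := by
  rw [sumOn_apply, ← hF.normal_spec.2.2.2]
  exact Finset.sum_le_sum_of_subset_of_nonneg (Finset.subset_univ _)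
    fun i _ _ => hF.normal_spec.2.1 i

theorem IsZeroFacet.sumOn_eq_zero (hF : IsZeroFacet L F) :
    sumOn S (facetNormal L F) = 0 ↔ S ⊆ F := by
  rw [sumOn_apply, Finset.sum_eq_zero_iff_of_nonneg fun i _ => hF.normal_spec.2.1 i]
  exact forall₂_congr fun i _ => hF.normal_spec.2.2.1 i

theorem IsZeroFacet.sumOn_pos (hF : IsZeroFacet L F) (h : ¬ S ⊆ F) :
    0 < sumOn S (facetNormal L F) :=
  lt_of_le_of_ne (hF.sumOn_nonneg S) fun e => h (hF.sumOn_eq_zero.1 e.symm)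

/-! ### Ridges crossing a partition of the facets. -/

/-- `R` is a face of corank two lying in a facet satisfying `A` and in one not satisfying `A`. -/
def IsCrossing (L : Submodule ℝ (ι → ℝ)) (A : Finset ι → Prop) (R : Finset ι) : Prop :=
  IsZeroFace L R ∧ corank L R = 2 ∧
    ∃ F F', IsZeroFacet L F ∧ IsZeroFacet L F' ∧ R ⊆ F ∧ R ⊆ F' ∧ A F ∧ ¬ A F'

theorem IsCrossing.swap {A : Finset ι → Prop} (h : IsCrossing L A R) :
    IsCrossing L (fun F => ¬ A F) R := by
  obtain ⟨h1, h2, F, F', h3, h4, h5, h6, h7, h8⟩ := h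
  exact ⟨h1, h2, F', F, h4, h3, h6, h5, h8, not_not.2 h7⟩

theorem isCrossing_not {A : Finset ι → Prop} :
    IsCrossing L (fun F => ¬ A F) R ↔ IsCrossing L A R :=
  ⟨fun h => by simpa using h.swap, fun h => h.swap⟩

/-- The functional `sumOn F'` is zero at `F'` and positive at every other facet. Its minimiser over
the facets through `G` in `A` is thus not optimal, and an improving neighbour must lie outside `A`.
-/
theorem exists_isCrossing {A : Finset ι → Prop} (hF : IsZeroFacet L F) (hF' : IsZeroFacet L F')
    (hGF : G ⊆ F) (hGF' : G ⊆ F') (hA : A F) (hA' : ¬ A F') : ∃ R, IsCrossing L A R ∧ G ⊆ R := by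
  classical
  obtain ⟨K, hK, hmin⟩ := Finset.exists_min_image
    {K : Finset ι | IsZeroFacet L K ∧ G ⊆ K ∧ A K} (fun K => sumOn F' (facetNormal L K))
    ⟨F, by simp [hF, hGF, hA]⟩
  simp only [Finset.mem_filter, Finset.mem_univ, true_and] at hK hmin
  obtain ⟨hK, hGK, hAK⟩ := hK
  obtain ⟨K', hK', hGK', hc, hlt⟩ := hK.exists_adjacent_lt hGK hF' hGF' (sumOn F') <| by
    rw [hF'.sumOn_eq_zero.2 subset_rfl]
    exact hK.sumOn_pos fun h => hA' (hF'.eq_of_subset hK h ▸ hAK)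
  refine ⟨K ∩ K', ⟨hK.1.inter hK'.1, hc, K, K', hK, hK', Finset.inter_subset_left,
    Finset.inter_subset_right, hAK, fun h => ?_⟩, Finset.subset_inter hGK hGK'⟩
  exact absurd (hmin K' ⟨hK', hGK', h⟩) (not_le.2 hlt)

/-- A crossing ridge differs from `R` as soon as one of the two facets producing it does not contain
`R`. The functional to optimise is chosen to force this, with `F₁`, the facet farthest from `R`, as
the target. -/
theorem exists_isCrossing_ne_aux {A : Finset ι → Prop} (hGR : G ⊂ R) {F₁ : Finset ι}
    (hF₁ : IsZeroFacet L F₁) (hGF₁ : G ⊆ F₁) (hA : A F₁) (hRF₁ : ¬ R ⊆ F₁)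
    (hmax : ∀ K, IsZeroFacet L K → G ⊆ K →
      sumOn R (facetNormal L K) ≤ sumOn R (facetNormal L F₁))
    (hF' : IsZeroFacet L F') (hGF' : G ⊆ F') (hA' : ¬ A F') :
    ∃ R', IsCrossing L A R' ∧ G ⊆ R' ∧ R' ≠ R := by
  classical
  by_cases hB : ∃ K, IsZeroFacet L K ∧ G ⊆ K ∧ ¬ A K ∧ ¬ R ⊆ K
  · obtain ⟨K₀, hK₀, hGK₀, hAK₀, hRK₀⟩ := hB
    -- With this `ε`, the value of `κ` at `K₀` is at most `ε - 2 * ε < 0`, while it is nonnegative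
    -- at facets containing `R`; so the minimiser `K` does not contain `R`. The term `ε • sumOn F₁`
    -- makes `F₁` strictly better than `K` even if both maximise `sumOn R`.
    set ε := sumOn R (facetNormal L K₀) / 2 with hε
    have hpos := hK₀.sumOn_pos hRK₀
    let κ : (ι → ℝ) →ₗ[ℝ] ℝ := ε • sumOn F₁ - sumOn R
    have hκ : ∀ f, κ f = ε * sumOn F₁ f - sumOn R f := fun f => rfl
    obtain ⟨K, hK, hmin⟩ := Finset.exists_min_image
      {K : Finset ι | IsZeroFacet L K ∧ G ⊆ K ∧ ¬ A K} (fun K => κ (facetNormal L K))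
      ⟨F', by simp [hF', hGF', hA']⟩
    simp only [Finset.mem_filter, Finset.mem_univ, true_and] at hK hmin
    obtain ⟨hK, hGK, hAK⟩ := hK
    have hRK : ¬ R ⊆ K := fun hRK => by
      have h1 := hmin K₀ ⟨hK₀, hGK₀, hAK₀⟩
      rw [hκ, hκ, hK.sumOn_eq_zero.2 hRK] at h1
      have h2 := mul_nonneg (by linarith : 0 ≤ ε) (hK.sumOn_nonneg F₁)
      have h3 := mul_le_mul_of_nonneg_left (hK₀.sumOn_le_one F₁) (by linarith : 0 ≤ ε)
      linarith
    obtain ⟨K', hK', hGK', hc, hlt⟩ := hK.exists_adjacent_lt hGK hF₁ hGF₁ κ <| by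
      rw [hκ, hκ, hF₁.sumOn_eq_zero.2 subset_rfl]
      have h1 := hmax K hK hGK
      have h2 := mul_pos (by linarith : 0 < ε)
        (hK.sumOn_pos (S := F₁) fun h => hAK (hF₁.eq_of_subset hK h ▸ hA))
      linarith
    have hAK' : A K' := by
      by_contra h
      exact absurd (hmin K' ⟨hK', hGK', h⟩) (not_le.2 hlt)
    refine ⟨K ∩ K', ⟨hK.1.inter hK'.1, hc, K', K, hK', hK, Finset.inter_subset_right,
      Finset.inter_subset_left, hAK', hAK⟩, Finset.subset_inter hGK hGK', ?_⟩
    rintro rfl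
    exact hRK Finset.inter_subset_left
  · push Not at hB
    have hRF' := hB F' hF' hGF' hA'
    -- Every facet through `G` outside `A` now contains `R`, so a neighbour of `F'` with larger
    -- `sumOn R` misses part of `R` and hence lies in `A`.
    obtain ⟨K', hK', hGK', hc, hlt⟩ := hF'.exists_adjacent_lt hGF' hF₁ hGF₁ (-sumOn R) <| by
      rw [LinearMap.neg_apply, LinearMap.neg_apply, hF'.sumOn_eq_zero.2 hRF']
      linarith [hF₁.sumOn_pos hRF₁]
    rw [LinearMap.neg_apply, LinearMap.neg_apply, hF'.sumOn_eq_zero.2 hRF'] at hlt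
    have hRK' : ¬ R ⊆ K' := fun h => by
      rw [hK'.sumOn_eq_zero.2 h] at hlt
      exact lt_irrefl _ hlt
    have hAK' : A K' := by
      by_contra h
      exact hRK' (hB K' hK' hGK' h)
    refine ⟨F' ∩ K', ⟨hF'.1.inter hK'.1, hc, K', F', hK', hF', Finset.inter_subset_right,
      Finset.inter_subset_left, hAK', hA'⟩, Finset.subset_inter hGF' hGK', ?_⟩
    rintro rfl
    exact hRK' Finset.inter_subset_right

/-- The crossing relation is symmetric in the two classes, so the class of the facet maximising
`sumOn R` may be taken to be `A`. -/
theorem exists_isCrossing_ne {A : Finset ι → Prop} (hG : IsZeroFace L G) (hGR : G ⊂ R)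
    (hF : IsZeroFacet L F) (hF' : IsZeroFacet L F') (hGF : G ⊆ F) (hGF' : G ⊆ F') (hA : A F)
    (hA' : ¬ A F') : ∃ R', IsCrossing L A R' ∧ G ⊆ R' ∧ R' ≠ R := by
  classical
  obtain ⟨i, hiR, hiG⟩ := Finset.exists_of_ssubset hGR
  obtain ⟨K, hK, hGK, hiK⟩ := hG.exists_facet_notMem hiG
  obtain ⟨F₁, hF₁, hmax⟩ := Finset.exists_max_image
    {K : Finset ι | IsZeroFacet L K ∧ G ⊆ K} (fun K => sumOn R (facetNormal L K))
    ⟨K, by simp [hK, hGK]⟩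
  simp only [Finset.mem_filter, Finset.mem_univ, true_and, and_imp] at hF₁ hmax
  obtain ⟨hF₁, hGF₁⟩ := hF₁
  have hRF₁ : ¬ R ⊆ F₁ := fun h => by
    have h1 := hmax K hK hGK
    rw [hF₁.sumOn_eq_zero.2 h] at h1
    exact absurd (hK.sumOn_pos fun h => hiK (h hiR)) (not_lt.2 h1)
  by_cases hA₁ : A F₁
  · exact exists_isCrossing_ne_aux hGR hF₁ hGF₁ hA₁ hRF₁ hmax hF' hGF' hA'
  · obtain ⟨R', h1, h2⟩ := exists_isCrossing_ne_aux (A := fun F => ¬ A F) hGR hF₁ hGF₁ hA₁ hRF₁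
      hmax hF hGF (not_not.2 hA)
    exact ⟨R', isCrossing_not.1 h1, h2⟩

open Classical in
/-- A partition of the facets into two classes that both occur around `G` has at least
`corank L G - 1` crossing faces of corank two through `G`. -/
theorem corank_le_card_crossing {A : Finset ι → Prop} (hG : IsZeroFace L G)
    (hF : IsZeroFacet L F) (hF' : IsZeroFacet L F') (hGF : G ⊆ F) (hGF' : G ⊆ F') (hA : A F)
    (hA' : ¬ A F') :
    corank L G ≤ ({R : Finset ι | IsCrossing L A R ∧ G ⊆ R} : Finset (Finset ι)).card + 1 := by
  induction hn : corank L G generalizing G F F' with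
  | zero => omega
  | succ n ih =>
  obtain ⟨R, hR, hGR⟩ := exists_isCrossing hF hF' hGF hGF' hA hA'
  by_cases hGR' : G = R
  · subst hGR'
    have h1 : 0 < ({R : Finset ι | IsCrossing L A R ∧ G ⊆ R} : Finset (Finset ι)).card :=
      Finset.card_pos.2 ⟨G, by simp [hR]⟩
    have := hR.2.1
    omega
  obtain ⟨R', hR', hGR'', hne⟩ := exists_isCrossing_ne hG
    (Finset.ssubset_iff_subset_ne.2 ⟨hGR, hGR'⟩) hF hF' hGF hGF' hA hA'
  -- `K ⊆ R` keeps both classes present around `K`; `K ⊄ R'` leaves `R'` out of the crossings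
  -- counted through `K`.
  obtain ⟨K, hK, hGK, hKR, hKR', hc⟩ := hG.exists_cover_not_subset hR.1 hR'.1 hGR hGR'' fun h =>
    hne (hR.1.eq_of_subset h (by rw [hR.2.1, hR'.2.1])).symm
  obtain ⟨-, -, F₁, F₂, h1, h2, h3, h4, h5, h6⟩ := hR
  have key := ih hK h1 h2 (hKR.trans h3) (hKR.trans h4) h5 h6 (by omega)
  have : ({R : Finset ι | IsCrossing L A R ∧ K ⊆ R} : Finset (Finset ι)).card <
      ({R : Finset ι | IsCrossing L A R ∧ G ⊆ R} : Finset (Finset ι)).card := by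
    refine Finset.card_lt_card ((Finset.ssubset_iff_of_subset fun S hS => ?_).2 ⟨R', ?_, ?_⟩)
    · simp only [Finset.mem_filter, Finset.mem_univ, true_and] at hS ⊢
      exact ⟨hS.1, hGK.1.trans hS.2⟩
    · simp [hR', hGR'']
    · simp [hKR']
  omega

end FunctionFaces

/-! ### From exposed faces and dimensions to zero faces and coranks. -/

section PolytopeFaces

variable {ι : Type*} [Fintype ι] {E : Type*} [NormedAddCommGroup E] [NormedSpace ℝ E]

/-- The values at the points `p i` of the affine function with linear part `a.1` and constant
term `a.2`. -/
def affineEval (p : ι → E) : (Module.Dual ℝ E × ℝ) →ₗ[ℝ] (ι → ℝ) where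
  toFun a i := a.1 (p i) + a.2
  map_add' a b := by ext i; simp; ring
  map_smul' c a := by ext i; simp; ring

@[simp] theorem affineEval_apply (p : ι → E) (f : Module.Dual ℝ E) (c : ℝ) (i : ι) :
    affineEval p (f, c) i = f (p i) + c := rfl

/-- The restrictions of affine functions to a finite family of points. -/
def affineFunctions (p : ι → E) : Submodule ℝ (ι → ℝ) := LinearMap.range (affineEval p)

theorem const_mem_affineFunctions (p : ι → E) (c : ℝ) :
    (fun _ => c) ∈ affineFunctions p := ⟨(0, c), by ext i; simp⟩

theorem isZeroFace_empty (p : ι → E) : IsZeroFace (affineFunctions p) ∅ :=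
  ⟨_, const_mem_affineFunctions p 1, fun _ => zero_le_one, fun _ => by simp⟩

theorem exists_weights_of_mem_convexHull {p : ι → E} {x : E}
    (hx : x ∈ convexHull ℝ (Set.range p)) :
    ∃ w : ι → ℝ, (∀ i, 0 ≤ w i) ∧ ∑ i, w i = 1 ∧ ∑ i, w i • p i = x := by
  classical
  have : convexHull ℝ (Set.range p) ⊆ Fintype.linearCombination ℝ p '' stdSimplex ℝ ι := by
    refine convexHull_min ?_ ((convex_stdSimplex ℝ ι).linear_image _)
    rintro _ ⟨i, rfl⟩
    exact ⟨Pi.single i 1, single_mem_stdSimplex ℝ i, by simp⟩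
  obtain ⟨w, hw, rfl⟩ := this hx
  exact ⟨w, hw.1, hw.2, by simp [Fintype.linearCombination_apply]⟩

/-- An affine function at a convex combination is the weighted mean of its values at the points; if
these are nonnegative, the mean vanishes only when all weight sits on zeros. -/
theorem zero_iff_mem_convexHull {p : ι → E} {f : Module.Dual ℝ E} {c : ℝ}
    (h0 : ∀ i, 0 ≤ f (p i) + c) {S : Finset ι} (hS : ∀ i, f (p i) + c = 0 ↔ i ∈ S) {x : E}
    (hx : x ∈ convexHull ℝ (Set.range p)) :
    0 ≤ f x + c ∧ (f x + c = 0 ↔ x ∈ convexHull ℝ (p '' S)) := by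
  obtain ⟨w, w0, w1, rfl⟩ := exists_weights_of_mem_convexHull hx
  have hsum : f (∑ i, w i • p i) + c = ∑ i, w i * (f (p i) + c) := by
    simp [mul_add, Finset.sum_add_distrib, ← Finset.sum_mul, w1]
  rw [hsum]
  refine ⟨Finset.sum_nonneg fun i _ => mul_nonneg (w0 i) (h0 i), fun h => ?_, fun h => ?_⟩
  · rw [Finset.sum_eq_zero_iff_of_nonneg fun i _ => mul_nonneg (w0 i) (h0 i)] at h
    have hw : ∀ i, i ∉ S → w i = 0 := fun i hi =>
      (mul_eq_zero.1 (h i (Finset.mem_univ i))).resolve_right fun e => hi ((hS i).1 e)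
    rw [← Finset.sum_subset (Finset.subset_univ S) fun i _ hi => by rw [hw i hi, zero_smul]]
    rw [← Finset.sum_subset (Finset.subset_univ S) fun i _ hi => hw i hi] at w1
    exact (convex_convexHull ℝ _).sum_mem (fun i _ => w0 i) w1
      fun i hi => subset_convexHull ℝ _ ⟨i, hi, rfl⟩
  · rw [← hsum]
    refine convexHull_min (t := {x | f x + c = 0}) ?_ ?_ h
    · rintro _ ⟨i, hi, rfl⟩
      exact (hS i).2 hi
    · intro x hx y hy a b _ _ hab
      simp only [Set.mem_ofPred_eq, map_add, map_smul, smul_eq_mul] at hx hy ⊢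
      linear_combination a * hx + b * hy - c * hab

open Classical in
/-- The indices of the points of a family lying in a set. -/
noncomputable def indicesIn (p : ι → E) (F : Set E) : Finset ι := {i | p i ∈ F}

@[simp] theorem mem_indicesIn {p : ι → E} {F : Set E} {i : ι} : i ∈ indicesIn p F ↔ p i ∈ F := by
  simp [indicesIn]

theorem IsExposed.isZeroFace_indicesIn {p : ι → E} {F : Set E}
    (hF : IsExposed ℝ (convexHull ℝ (Set.range p)) F) :
    IsZeroFace (affineFunctions p) (indicesIn p F) ∧ F = convexHull ℝ (p '' indicesIn p F) := by
  rcases F.eq_empty_or_nonempty with rfl | hne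
  · have : indicesIn p ∅ = ∅ := by ext; simp
    rw [this]
    exact ⟨isZeroFace_empty p, by simp⟩
  obtain ⟨l, hl⟩ := hF hne
  obtain ⟨x₀, hx₀⟩ := hne
  have hP : ∀ i, p i ∈ convexHull ℝ (Set.range p) := fun i => subset_convexHull ℝ _ ⟨i, rfl⟩
  have hx₀' := hx₀
  rw [hl] at hx₀'
  -- Exposed faces maximise `l`, so the nonnegative function vanishing on `F` is `l x₀ - l`.
  have hmem : ∀ x ∈ convexHull ℝ (Set.range p), x ∈ F ↔ -(l : Module.Dual ℝ E) x + l x₀ = 0 := by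
    intro x hx
    rw [hl]
    have h1 := hx₀'.2 x hx
    refine ⟨fun h => ?_, fun h => ⟨hx, fun y hy => ?_⟩⟩
    · have := h.2 x₀ hx₀'.1
      simp only [ContinuousLinearMap.coe_coe]
      linarith
    · have := hx₀'.2 y hy
      simp only [ContinuousLinearMap.coe_coe] at h
      linarith
  have h0 : ∀ i, 0 ≤ (-(l : Module.Dual ℝ E)) (p i) + l x₀ := fun i => by
    have := hx₀'.2 _ (hP i)
    simp only [LinearMap.neg_apply, ContinuousLinearMap.coe_coe]
    linarith
  have hz : ∀ i, (-(l : Module.Dual ℝ E)) (p i) + l x₀ = 0 ↔ i ∈ indicesIn p F := fun i => by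
    rw [mem_indicesIn, hmem _ (hP i), LinearMap.neg_apply]
  refine ⟨⟨_, ⟨(-(l : Module.Dual ℝ E), l x₀), rfl⟩, h0, hz⟩, ?_⟩
  ext x
  constructor
  · intro hx
    have hxP := hF.subset hx
    refine (zero_iff_mem_convexHull h0 hz hxP).2.1 ?_
    rw [LinearMap.neg_apply]
    exact (hmem x hxP).1 hx
  · intro hx
    have hxP : x ∈ convexHull ℝ (Set.range p) :=
      convexHull_mono (Set.image_subset_range _ _) hx
    exact (hmem x hxP).2 ((zero_iff_mem_convexHull h0 hz hxP).2.2 hx)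

variable [FiniteDimensional ℝ E]

theorem IsZeroFace.isExposed {p : ι → E} {S : Finset ι}
    (hS : IsZeroFace (affineFunctions p) S) :
    IsExposed ℝ (convexHull ℝ (Set.range p)) (convexHull ℝ (p '' S)) ∧
      indicesIn p (convexHull ℝ (p '' S)) = S := by
  obtain ⟨_, ⟨⟨f, c⟩, rfl⟩, h0, hz⟩ := hS
  simp only [affineEval_apply] at h0 hz
  have hP : ∀ i, p i ∈ convexHull ℝ (Set.range p) := fun i => subset_convexHull ℝ _ ⟨i, rfl⟩
  have hsub : convexHull ℝ (p '' S) ⊆ convexHull ℝ (Set.range p) :=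
    convexHull_mono (Set.image_subset_range _ _)
  refine ⟨fun ⟨x₀, hx₀⟩ => ⟨LinearMap.toContinuousLinearMap (-f), ?_⟩, ?_⟩
  · have h1 := (zero_iff_mem_convexHull h0 hz (hsub hx₀)).2.2 hx₀
    ext x
    simp only [Set.mem_ofPred_eq, LinearMap.coe_toContinuousLinearMap', LinearMap.neg_apply,
      neg_le_neg_iff]
    refine ⟨fun hx => ⟨hsub hx, fun y hy => ?_⟩, fun ⟨hx, h⟩ => ?_⟩
    · have h2 := (zero_iff_mem_convexHull h0 hz (hsub hx)).2.2 hx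
      have h3 := (zero_iff_mem_convexHull h0 hz hy).1
      linarith
    · obtain ⟨h2, h3⟩ := zero_iff_mem_convexHull h0 hz hx
      refine h3.1 (le_antisymm ?_ h2)
      linarith [h x₀ (hsub hx₀)]
  · ext i
    rw [mem_indicesIn, ← (zero_iff_mem_convexHull h0 hz (hP i)).2, hz]

/-- The faces of the convex hull of a finite family correspond to the zero faces. -/
noncomputable def faceLatticeEquiv (p : ι → E) :
    FaceLattice (convexHull ℝ (Set.range p)) ≃o {S // IsZeroFace (affineFunctions p) S} where
  toFun F := ⟨indicesIn p F.1, F.2.isZeroFace_indicesIn.1⟩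
  invFun S := ⟨convexHull ℝ (p '' S.1), S.2.isExposed.1⟩
  left_inv F := Subtype.ext F.2.isZeroFace_indicesIn.2.symm
  right_inv S := Subtype.ext S.2.isExposed.2
  map_rel_iff' := by
    rintro ⟨F, hF⟩ ⟨G, hG⟩
    simp only [Equiv.coe_fn_mk, Subtype.mk_le_mk]
    refine ⟨fun h => ?_, fun h i => ?_⟩
    · rw [hF.isZeroFace_indicesIn.2, hG.isZeroFace_indicesIn.2]
      exact convexHull_mono (Set.image_mono h)
    · simpa using fun hi => h hi

/-- The affine functions vanishing at the points with index in `S`. -/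
def affineVanishing (p : ι → E) (S : Finset ι) : Submodule ℝ (Module.Dual ℝ E × ℝ) :=
  (vanishing ⊤ S).comap (affineEval p)

theorem mem_affineVanishing {p : ι → E} {S : Finset ι} {a : Module.Dual ℝ E × ℝ} :
    a ∈ affineVanishing p S ↔ ∀ i ∈ S, a.1 (p i) + a.2 = 0 :=
  ⟨fun h => h.2, fun h => ⟨trivial, h⟩⟩

/-- Rank-nullity for `affineEval`. The kernel term is nonzero when the points do not affinely span
`E`. -/
theorem corank_add_finrank_ker (p : ι → E) (S : Finset ι) :
    corank (affineFunctions p) S + Module.finrank ℝ (affineVanishing p Finset.univ) =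
      Module.finrank ℝ (affineVanishing p S) := by
  have h1 : vanishing (affineFunctions p) S =
      LinearMap.range ((affineEval p).domRestrict (affineVanishing p S)) := by
    ext f
    constructor
    · rintro ⟨⟨a, rfl⟩, h⟩
      exact ⟨⟨a, mem_affineVanishing.2 h⟩, rfl⟩
    · rintro ⟨⟨a, ha⟩, rfl⟩
      exact ⟨⟨a, rfl⟩, mem_affineVanishing.1 ha⟩
  have h2 : LinearMap.ker ((affineEval p).domRestrict (affineVanishing p S)) =
      (affineVanishing p Finset.univ).comap (affineVanishing p S).subtype := by
    ext ⟨a, ha⟩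
    simp only [LinearMap.mem_ker, LinearMap.domRestrict_apply, Submodule.mem_comap,
      Submodule.subtype_apply, mem_affineVanishing, funext_iff, Finset.mem_univ, true_imp_iff]
    rfl
  have hle : affineVanishing p Finset.univ ≤ affineVanishing p S := fun a ha =>
    mem_affineVanishing.2 fun i _ => mem_affineVanishing.1 ha i (Finset.mem_univ i)
  have h3 := LinearMap.finrank_range_add_finrank_ker (K := ℝ)
    (V := affineVanishing p S) ((affineEval p).domRestrict (affineVanishing p S))
  rw [h2, (Submodule.comapSubtypeEquivOfLe hle).finrank_eq, ← h1] at h3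
  exact h3

/-- Vanishing on `S` means that the linear part annihilates the differences of the points and that
one point, which exists as `S` is nonempty, determines the constant. -/
theorem finrank_affineVanishing (p : ι → E) {S : Finset ι} (hS : S.Nonempty) :
    Module.finrank ℝ (vectorSpan ℝ (p '' S)) + Module.finrank ℝ (affineVanishing p S) =
      Module.finrank ℝ E := by
  obtain ⟨j, hj⟩ := hS
  rw [← Subspace.finrank_add_finrank_dualAnnihilator_eq (vectorSpan ℝ (p '' S))]
  congr 1
  have hmem : ∀ f : Module.Dual ℝ E, f ∈ (vectorSpan ℝ (p '' S)).dualAnnihilator ↔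
      ∀ i ∈ S, f (p i) = f (p j) := by
    intro f
    rw [vectorSpan_eq_span_vsub_set_right ℝ (Set.mem_image_of_mem p hj),
      Submodule.mem_dualAnnihilator]
    refine ⟨fun h i hi => ?_, fun h x hx => ?_⟩
    · have := h (p i - p j) (Submodule.subset_span ⟨p i, ⟨i, hi, rfl⟩, rfl⟩)
      rwa [map_sub, sub_eq_zero] at this
    · refine LinearMap.mem_ker.1 (Submodule.span_le.2 ?_ hx : x ∈ LinearMap.ker f)
      rintro _ ⟨_, ⟨i, hi, rfl⟩, rfl⟩
      simp [h i hi]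
  refine LinearEquiv.finrank_eq (LinearEquiv.ofBijective
    ((LinearMap.fst ℝ (Module.Dual ℝ E) ℝ).restrict (p := affineVanishing p S)
      (q := (vectorSpan ℝ (p '' S)).dualAnnihilator) fun a ha => ?_) ⟨?_, ?_⟩)
  · rw [mem_affineVanishing] at ha
    refine (hmem _).2 fun i hi => ?_
    have h1 := ha i hi
    have h2 := ha j hj
    simp only [LinearMap.fst_apply]
    linarith
  · rintro ⟨⟨f, c⟩, ha⟩ ⟨⟨f', c'⟩, ha'⟩ h
    obtain rfl : f = f' := congrArg Subtype.val h
    have h1 := mem_affineVanishing.1 ha j hj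
    have h2 := mem_affineVanishing.1 ha' j hj
    obtain rfl : c = c' := by simp only at h1 h2; linarith
    rfl
  · rintro ⟨f, hf⟩
    exact ⟨⟨(f, -f (p j)), mem_affineVanishing.2 fun i hi => by simp [(hmem f).1 hf i hi]⟩, rfl⟩

theorem finrank_direction_convexHull (s : Set E) :
    Module.finrank ℝ (affineSpan ℝ (convexHull ℝ s)).direction =
      Module.finrank ℝ (vectorSpan ℝ s) := by
  rw [affineSpan_convexHull, direction_affineSpan]

theorem corank_empty {p : ι → E} {d : ℕ}
    (hd : HasAffineDim (convexHull ℝ (Set.range p)) d) :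
    corank (affineFunctions p) ∅ = d + 1 := by
  obtain ⟨hne, hd⟩ := hd
  rw [convexHull_nonempty_iff, Set.range_nonempty_iff_nonempty] at hne
  rw [finrank_direction_convexHull] at hd
  have h1 := corank_add_finrank_ker p ∅
  have h2 := finrank_affineVanishing p (S := Finset.univ) Finset.univ_nonempty
  rw [Finset.coe_univ, Set.image_univ, hd] at h2
  have h3 : affineVanishing p ∅ = ⊤ :=
    eq_top_iff.2 fun a _ => mem_affineVanishing.2 (by simp)
  rw [h3, finrank_top, Module.finrank_prod, Module.finrank_self, Subspace.dual_finrank_eq] at h1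
  omega

theorem hasAffineDim_iff_corank {p : ι → E} {d k : ℕ}
    (hd : HasAffineDim (convexHull ℝ (Set.range p)) d) {F : Set E}
    (hF : IsExposed ℝ (convexHull ℝ (Set.range p)) F) :
    HasAffineDim F k ↔ corank (affineFunctions p) (indicesIn p F) + k = d := by
  obtain ⟨-, hF'⟩ := hF.isZeroFace_indicesIn
  rcases F.eq_empty_or_nonempty with rfl | hne
  · have : indicesIn p (∅ : Set E) = ∅ := by ext; simp
    rw [this, corank_empty hd, HasAffineDim]
    simp only [Set.not_nonempty_empty, false_and, false_iff]
    omega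
  have hS : (indicesIn p F).Nonempty := by
    rw [hF', convexHull_nonempty_iff] at hne
    simpa using hne
  obtain ⟨hne', hd⟩ := hd
  rw [convexHull_nonempty_iff, Set.range_nonempty_iff_nonempty] at hne'
  rw [finrank_direction_convexHull] at hd
  have h1 := corank_add_finrank_ker p (indicesIn p F)
  have h2 := finrank_affineVanishing p (S := Finset.univ) Finset.univ_nonempty
  rw [Finset.coe_univ, Set.image_univ, hd] at h2
  have h3 := finrank_affineVanishing p hS
  have h4 : Module.finrank ℝ (affineSpan ℝ F).direction =
      Module.finrank ℝ (vectorSpan ℝ (p '' indicesIn p F)) := by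
    conv_lhs => rw [hF']
    exact finrank_direction_convexHull _
  rw [HasAffineDim, h4]
  simp only [hne, true_and]
  omega

theorem IsConvexPolytope.exists_family {P : Set E} (hP : IsConvexPolytope P) :
    ∃ (n : ℕ) (p : Fin n → E), P = convexHull ℝ (Set.range p) := by
  obtain ⟨s, hs, rfl⟩ := hP
  obtain ⟨n, p, hp⟩ := hs.fin_param
  exact ⟨n, p, by rw [hp.2]⟩

end PolytopeFaces

/-! ### The ridge graph is `d`-connected. -/

section RidgeGraph

open Classical in
/-- The number of faces of corank two. -/
theorem lt_card_corank_two {ι : Type*} [Fintype ι] {L : Submodule ℝ (ι → ℝ)} {d : ℕ} (hd : 2 ≤ d)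
    (h0 : IsZeroFace L ∅) (hc : corank L ∅ = d + 1) :
    d < ({R | IsZeroFace L R ∧ corank L R = 2} : Finset (Finset ι)).card := by
  obtain ⟨F, hF, -⟩ := h0.subset_facet (by omega)
  obtain ⟨i, hi⟩ : F.Nonempty := by
    rw [Finset.nonempty_iff_ne_empty]
    rintro rfl
    have := hF.2
    omega
  obtain ⟨F', hF', -, hi'⟩ := h0.exists_facet_notMem (Finset.notMem_empty i)
  have hne : F ≠ F' := by rintro rfl; exact hi' hi
  -- For the class consisting of `F` alone, the crossing ridges lie in `F`, which gives `d` ridges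
  -- there. One more is a ridge of `F'` not in `F`: otherwise every crossing ridge for `F'` would
  -- equal `F ∩ F'`, against there being `d ≥ 2` of them.
  have h1 := corank_le_card_crossing (A := (· = F)) h0 hF hF' (Finset.empty_subset _)
    (Finset.empty_subset _) rfl hne.symm
  have h2 := corank_le_card_crossing (A := (· = F')) h0 hF' hF (Finset.empty_subset _)
    (Finset.empty_subset _) rfl hne
  have hint : 2 ≤ corank L (F ∩ F') := by
    have := (hF.1.inter hF'.1).corank_lt (T := F) (Finset.ssubset_iff_subset_ne.2
      ⟨Finset.inter_subset_left, fun e => hne (hF.eq_of_subset hF' (Finset.inter_eq_left.1 e))⟩)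
    rw [hF.2] at this
    omega
  obtain ⟨R, hR, hRF⟩ : ∃ R, IsCrossing L (· = F') R ∧ ¬ R ⊆ F := by
    by_contra! hcon
    have : ({R : Finset ι | IsCrossing L (· = F') R ∧ ∅ ⊆ R} : Finset (Finset ι)) ⊆ {F ∩ F'} := by
      intro R hR
      simp only [Finset.mem_filter, Finset.mem_univ, true_and] at hR
      obtain ⟨⟨h3, h4, K, -, -, -, h5, -, rfl, -⟩, -⟩ := id hR
      exact Finset.mem_singleton.2 (h3.eq_of_subset
        (Finset.subset_inter (hcon R hR.1) h5) (by omega))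
    have := Finset.card_le_card this
    rw [Finset.card_singleton] at this
    omega
  have : ({R : Finset ι | IsCrossing L (· = F) R ∧ ∅ ⊆ R} : Finset (Finset ι)).card <
      ({R | IsZeroFace L R ∧ corank L R = 2} : Finset (Finset ι)).card := by
    refine Finset.card_lt_card ((Finset.ssubset_iff_of_subset fun S hS => ?_).2 ⟨R, ?_, ?_⟩)
    · simp only [Finset.mem_filter, Finset.mem_univ, true_and] at hS ⊢
      exact ⟨hS.1.1, hS.1.2.1⟩
    · simp [hR.1, hR.2.1]
    · simp only [Finset.mem_filter, Finset.mem_univ, true_and, not_and]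
      rintro ⟨-, -, K, -, -, -, h5, -, rfl, -⟩
      exact absurd h5 hRF
  omega

variable {ι : Type*} [Fintype ι] {E : Type*} [NormedAddCommGroup E] [NormedSpace ℝ E]
  [FiniteDimensional ℝ E] {p : ι → E} {d : ℕ}

theorem IsExposed.subset_iff_indicesIn {F G : Set E}
    (hF : IsExposed ℝ (convexHull ℝ (Set.range p)) F)
    (hG : IsExposed ℝ (convexHull ℝ (Set.range p)) G) :
    F ⊆ G ↔ indicesIn p F ⊆ indicesIn p G :=
  ((faceLatticeEquiv p).le_iff_le (x := ⟨F, hF⟩) (y := ⟨G, hG⟩)).symm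

/-- The faces of dimension `k` of a `d`-dimensional polytope correspond to the zero faces of
corank `d - k`. -/
noncomputable def faceOfDimEquiv (hd : HasAffineDim (convexHull ℝ (Set.range p)) d) (k : ℕ) :
    FaceOfDim (convexHull ℝ (Set.range p)) k ≃
      {S // IsZeroFace (affineFunctions p) S ∧ corank (affineFunctions p) S + k = d} where
  toFun F := ⟨indicesIn p F.1, F.2.1.isZeroFace_indicesIn.1,
    (hasAffineDim_iff_corank hd F.2.1).1 F.2.2⟩
  invFun S := ⟨convexHull ℝ (p '' S.1), S.2.1.isExposed.1, by
    rw [hasAffineDim_iff_corank hd S.2.1.isExposed.1, S.2.1.isExposed.2]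
    exact S.2.2⟩
  left_inv F := Subtype.ext F.2.1.isZeroFace_indicesIn.2.symm
  right_inv S := Subtype.ext S.2.1.isExposed.2

theorem faceGraph_adj_iff (hd : HasAffineDim (convexHull ℝ (Set.range p)) d) {k : ℕ}
    {F G : FaceOfDim (convexHull ℝ (Set.range p)) k} :
    (faceGraph (convexHull ℝ (Set.range p)) k).Adj F G ↔ F ≠ G ∧ ∃ H,
      IsZeroFace (affineFunctions p) H ∧ corank (affineFunctions p) H + (k + 1) = d ∧
        indicesIn p F.1 ⊆ H ∧ indicesIn p G.1 ⊆ H := by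
  refine and_congr_right fun _ => ⟨fun ⟨H, h1, h2⟩ => ?_, fun ⟨H, h1, h2, h3, h4⟩ => ?_⟩
  · exact ⟨_, (faceOfDimEquiv hd _ H).2.1, (faceOfDimEquiv hd _ H).2.2,
      (F.2.1.subset_iff_indicesIn H.2.1).1 h1, (G.2.1.subset_iff_indicesIn H.2.1).1 h2⟩
  · refine ⟨(faceOfDimEquiv hd _).symm ⟨H, h1, h2⟩, ?_, ?_⟩
    · refine (F.2.1.subset_iff_indicesIn h1.isExposed.1).2 ?_
      rwa [h1.isExposed.2]
    · refine (G.2.1.subset_iff_indicesIn h1.isExposed.1).2 ?_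
      rwa [h1.isExposed.2]

theorem isVertexConnected_faceGraph (hd2 : 2 ≤ d)
    (hd : HasAffineDim (convexHull ℝ (Set.range p)) d) :
    IsVertexConnected (faceGraph (convexHull ℝ (Set.range p)) (d - 2)) d := by
  classical
  set V := FaceOfDim (convexHull ℝ (Set.range p)) (d - 2)
  set L := affineFunctions p
  let e := faceOfDimEquiv hd (d - 2)
  have h0 : IsZeroFace L ∅ := isZeroFace_empty p
  have hc0 : corank L ∅ = d + 1 := corank_empty hd
  have hcard : (d : ℕ∞) + 1 ≤ ENat.card V := by
    let e' : V ≃ ({R | IsZeroFace L R ∧ corank L R = 2} : Finset (Finset ι)) :=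
      e.trans (Equiv.subtypeEquivRight fun S => by
        simp only [Finset.mem_filter, Finset.mem_univ, true_and, L]
        exact and_congr_right fun _ => by omega)
    rw [ENat.card_congr e', ENat.card_eq_coe_fintype_card, Fintype.card_coe]
    exact_mod_cast lt_card_corank_two hd2 h0 hc0
  have hadj : ∀ {R R' : V} {F : Finset ι}, IsZeroFacet L F → indicesIn p R.1 ⊆ F →
      indicesIn p R'.1 ⊆ F → R = R' ∨ (faceGraph (convexHull ℝ (Set.range p)) (d - 2)).Adj R R' := by
    intro R R' F hF h1 h2
    by_cases h : R = R'
    · exact Or.inl h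
    · exact Or.inr ((faceGraph_adj_iff hd).2 ⟨h, F, hF.1, by rw [hF.2]; omega, h1, h2⟩)
  have hfacet : ∀ R : V, ∃ F, IsZeroFacet L F ∧ indicesIn p R.1 ⊆ F := fun R =>
    (e R).2.1.subset_facet (by have := (e R).2.2; omega)
  refine ⟨hcard, fun S hS => ?_⟩
  rw [SimpleGraph.connected_iff]
  constructor
  · intro R R'
    by_contra hR
    -- The reached facets. Ridges of a common facet are adjacent or equal, so every undeleted ridge
    -- of a reached facet is reachable.
    let A : Finset ι → Prop := fun F => ∃ C : ((S : Set V)ᶜ : Set V),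
      ((faceGraph (convexHull ℝ (Set.range p)) (d - 2)).induce ((S : Set V)ᶜ)).Reachable R C ∧
        indicesIn p C.1.1 ⊆ F
    have hstep : ∀ {F : Finset ι} (C : ((S : Set V)ᶜ : Set V)), IsZeroFacet L F → A F →
        indicesIn p C.1.1 ⊆ F →
        ((faceGraph (convexHull ℝ (Set.range p)) (d - 2)).induce ((S : Set V)ᶜ)).Reachable R C := by
      rintro F C hF ⟨D, hD, hDF⟩ hCF
      rcases hadj hF hDF hCF with h | h
      · rwa [← Subtype.ext h]
      · exact hD.trans (SimpleGraph.Adj.reachable h)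
    obtain ⟨F, hF, hRF⟩ := hfacet R.1
    obtain ⟨F', hF', hRF'⟩ := hfacet R'.1
    have key := corank_le_card_crossing (A := A) h0 hF hF' (Finset.empty_subset _)
      (Finset.empty_subset _) ⟨R, SimpleGraph.Reachable.refl _, hRF⟩
      fun h => hR (hstep R' hF' h hRF')
    have hsub : ({T : Finset ι | IsCrossing L A T ∧ ∅ ⊆ T} : Finset (Finset ι)) ⊆
        S.image fun R => indicesIn p R.1 := by
      intro T hT
      simp only [Finset.mem_filter, Finset.mem_univ, true_and] at hT
      obtain ⟨⟨hT, hTc, K, K', hK, hK', hTK, hTK', hAK, hAK'⟩, -⟩ := hT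
      have hTd : corank (affineFunctions p) T + (d - 2) = d := by
        rw [hTc]
        omega
      refine Finset.mem_image.2 ⟨e.symm ⟨T, hT, hTd⟩, ?_, hT.isExposed.2⟩
      by_contra hTS
      have hi : indicesIn p (e.symm ⟨T, hT, hTd⟩).1 = T := hT.isExposed.2
      -- An undeleted crossing ridge would be reachable through `K` and would make `K'` reached.
      exact hAK' ⟨⟨_, hTS⟩, hstep ⟨_, hTS⟩ hK hAK (by rwa [hi]), by rwa [hi]⟩
    have := (Finset.card_le_card hsub).trans Finset.card_image_le
    omega
  · by_contra hcon
    have huniv : ∀ R : V, R ∈ S := fun R => by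
      by_contra hR
      exact hcon ⟨⟨R, hR⟩⟩
    have : ENat.card V ≤ S.card := by
      rw [← ENat.card_congr (Equiv.subtypeUnivEquiv huniv)]
      simp
    have h1 := hcard.trans this
    have h2 : d + 1 ≤ S.card := by exact_mod_cast h1
    omega

end RidgeGraph

/-! ### Faces of the prism over a simplex. -/

section Prism

variable {E : Type*} [NormedAddCommGroup E] [NormedSpace ℝ E]

/-- The vertices of the prism over the simplex `Δ` in direction `u`. -/
def prismPoint {n : ℕ} (Δ : Affine.Simplex ℝ E n) (u : E) (v : Fin (n + 1) × Bool) : E :=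
  Δ.points v.1 + if v.2 then u else 0

open scoped Pointwise in
theorem convexHull_range_prismPoint {n : ℕ} (Δ : Affine.Simplex ℝ E n) (u : E) :
    convexHull ℝ (Set.range (prismPoint Δ u)) =
      convexHull ℝ (Set.range Δ.points) + segment ℝ 0 u := by
  rw [← convexHull_pair, ← convexHull_add]
  congr 1
  ext x
  simp only [Set.mem_range, Set.mem_add, Prod.exists, Bool.exists_bool, prismPoint]
  constructor
  · rintro ⟨i, rfl | rfl⟩
    · exact ⟨_, ⟨i, rfl⟩, 0, by simp, by simp⟩
    · exact ⟨_, ⟨i, rfl⟩, u, by simp, by simp⟩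
  · rintro ⟨_, ⟨i, rfl⟩, y, rfl | rfl, rfl⟩
    · exact ⟨i, Or.inl (by simp)⟩
    · exact ⟨i, Or.inr (by simp)⟩

theorem exists_linearMap_eq_of_linearIndependent {κ : Type*} {w : κ → E}
    (hw : LinearIndependent ℝ w) (a : κ → ℝ) : ∃ f : Module.Dual ℝ E, ∀ k, f (w k) = a k := by
  obtain ⟨f, hf⟩ := LinearMap.exists_extend ((Module.Basis.span hw).constr ℝ a)
  refine ⟨f, fun k => ?_⟩
  have h1 := LinearMap.congr_fun hf (Module.Basis.span hw k)
  rw [Module.Basis.constr_basis] at h1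
  rw [← h1, LinearMap.comp_apply, Submodule.subtype_apply, Module.Basis.span_apply]

/-- The edge vectors of `Δ` at a vertex together with `u` are linearly independent, so values on one
base and the increment along `u` can be prescribed freely. -/
theorem mem_affineFunctions_prismPoint {n : ℕ} {Δ : Affine.Simplex ℝ E n} {u : E}
    (hu : u ∉ (affineSpan ℝ (Set.range Δ.points)).direction) {g : Fin (n + 1) × Bool → ℝ} :
    g ∈ affineFunctions (prismPoint Δ u) ↔
      ∃ (a : Fin (n + 1) → ℝ) (c : ℝ), g = fun v => a v.1 + if v.2 then c else 0 := by
  constructor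
  · rintro ⟨⟨f, α⟩, rfl⟩
    refine ⟨fun i => f (Δ.points i) + α, f u, ?_⟩
    ext ⟨i, b⟩
    cases b <;> simp [prismPoint]
    ring
  · rintro ⟨a, c, rfl⟩
    have h1 := (affineIndependent_iff_linearIndependent_vsub ℝ _ 0).1 Δ.independent
    rw [direction_affineSpan, vectorSpan_range_eq_span_range_vsub_right_ne ℝ _ (0 : Fin (n + 1))]
      at hu
    obtain ⟨f, hf⟩ := exists_linearMap_eq_of_linearIndependent (h1.option hu)
      (fun o => Option.casesOn' o c fun i => a i.1 - a 0)
    have hfu : f u = c := hf none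
    have hfi : ∀ i, f (Δ.points i) - f (Δ.points 0) = a i - a 0 := fun i => by
      by_cases hi : i = 0
      · simp [hi]
      · simpa using hf (some ⟨i, hi⟩)
    refine ⟨(f, a 0 - f (Δ.points 0)), ?_⟩
    ext ⟨i, b⟩
    have := hfi i
    cases b <;> simp [prismPoint, hfu] <;> linarith

variable {n : ℕ} {Δ : Affine.Simplex ℝ E n} {u : E}

/-- The product of a face of the simplex and an end of the segment is a face of the prism. -/
theorem isZeroFace_prism_product_singleton
    (hu : u ∉ (affineSpan ℝ (Set.range Δ.points)).direction) (I : Finset (Fin (n + 1))) (b : Bool) :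
    IsZeroFace (affineFunctions (prismPoint Δ u)) (I ×ˢ {b}) := by
  refine ⟨_, (mem_affineFunctions_prismPoint hu).2
    ⟨fun i => (if i ∈ I then 0 else 1) + if b then 1 else 0, if b then -1 else 1, rfl⟩, ?_, ?_⟩
  · rintro ⟨i, b'⟩
    by_cases hi : i ∈ I <;> cases b <;> cases b' <;> norm_num [hi]
  · rintro ⟨i, b'⟩
    by_cases hi : i ∈ I <;> cases b <;> cases b' <;> norm_num [hi]

/-- The product of a face of the simplex and the segment is a face of the prism. -/
theorem isZeroFace_prism_product_univ
    (hu : u ∉ (affineSpan ℝ (Set.range Δ.points)).direction) (I : Finset (Fin (n + 1))) :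
    IsZeroFace (affineFunctions (prismPoint Δ u)) (I ×ˢ Finset.univ) := by
  refine ⟨_, (mem_affineFunctions_prismPoint hu).2 ⟨fun i => if i ∈ I then 0 else 1, 0, rfl⟩, ?_, ?_⟩
  · rintro ⟨i, b'⟩
    by_cases hi : i ∈ I <;> cases b' <;> norm_num [hi]
  · rintro ⟨i, b'⟩
    by_cases hi : i ∈ I <;> cases b' <;> norm_num [hi]

/-- A face of the prism that meets both bases contains a vertical edge. -/
theorem exists_vertical_subset (hu : u ∉ (affineSpan ℝ (Set.range Δ.points)).direction)
    {T : Finset (Fin (n + 1) × Bool)} (hT : IsZeroFace (affineFunctions (prismPoint Δ u)) T)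
    {v w : Fin (n + 1) × Bool} (hv : v ∈ T) (hw : w ∈ T) (hv2 : v.2 = false) (hw2 : w.2 = true) :
    {v.1} ×ˢ Finset.univ ⊆ T := by
  obtain ⟨i, b⟩ := v
  obtain ⟨j, b'⟩ := w
  obtain rfl : b = false := hv2
  obtain rfl : b' = true := hw2
  obtain ⟨g, hg, g0, gz⟩ := hT
  obtain ⟨a, c, rfl⟩ := (mem_affineFunctions_prismPoint hu).1 hg
  have h1 := (gz _).2 hv
  have h2 := (gz _).2 hw
  have h3 := g0 (j, false)
  have h4 := g0 (i, true)
  simp only [if_true, Bool.false_eq_true, if_false, add_zero] at h1 h2 h3 h4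
  rintro ⟨k, b⟩ hk
  obtain rfl : k = i := Finset.mem_singleton.1 (Finset.mem_product.1 hk).1
  cases b
  · exact hv
  · refine (gz _).1 ?_
    simp only [if_true]
    linarith

end Prism

/-! ### Separating the ridge graph of a dual of a prism. -/

section DualOfPrism

variable {ι : Type*} [Fintype ι] {E : Type*} [NormedAddCommGroup E] [NormedSpace ℝ E]
  [FiniteDimensional ℝ E] {p : ι → E} {d : ℕ}

/-- An anti-isomorphism transports only order, so coranks are recognised on the other side by the
lengths of chains up to the whole polytope; this lemma and the next make the two translations. -/
theorem not_chain_of_corank_two {L : Submodule ℝ (ι → ℝ)} {R a b : {S // IsZeroFace L S}}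
    (hR : corank L R.1 = 2) (h1 : R < a) (h2 : a < b) (h3 : b < ⟨_, isZeroFace_univ⟩) : False := by
  have h1 := R.2.corank_lt (h1)
  have h2 := a.2.corank_lt (h2)
  have h3 := b.2.corank_lt (h3)
  omega

theorem exists_chain_of_two_lt_corank {L : Submodule ℝ (ι → ℝ)} {R : {S // IsZeroFace L S}}
    (hR : 2 < corank L R.1) : ∃ a b : {S // IsZeroFace L S},
      R < a ∧ a < b ∧ b < ⟨_, isZeroFace_univ⟩ := by
  have hne : R.1 ⊂ Finset.univ := by
    refine Finset.ssubset_univ_iff.2 fun h => ?_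
    rw [h, corank_univ] at hR
    omega
  obtain ⟨K, hK, h1, h2, h3⟩ := R.2.exists_cocover isZeroFace_univ hne
  rw [corank_univ] at h3
  have hRK : R.1 ⊂ K := Finset.ssubset_iff_subset_ne.2 ⟨h1, by rintro rfl; omega⟩
  obtain ⟨K', hK', h4, h5⟩ := R.2.exists_between hK hRK (by omega)
  exact ⟨⟨K', hK'⟩, ⟨K, hK⟩, h4, h5, h2⟩

theorem not_isVertexConnected_faceGraph_of_dual_prism {E' : Type*} [NormedAddCommGroup E']
    [NormedSpace ℝ E'] {n : ℕ} (hn : 1 ≤ n)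
    (hd : HasAffineDim (convexHull ℝ (Set.range p)) (n + 1)) {Δ : Affine.Simplex ℝ E' n} {u : E'}
    (hu : u ∉ (affineSpan ℝ (Set.range Δ.points)).direction)
    (Ψ : {S // IsZeroFace (affineFunctions p) S} ≃o
      {T // IsZeroFace (affineFunctions (prismPoint Δ u)) T}ᵒᵈ) :
    ¬ IsVertexConnected (faceGraph (convexHull ℝ (Set.range p)) (n - 1)) (n + 2) := by
  classical
  set L := affineFunctions p
  set L' := affineFunctions (prismPoint Δ u)
  set V := FaceOfDim (convexHull ℝ (Set.range p)) (n - 1)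
  let e := faceOfDimEquiv hd (n - 1)
  have : Fintype V := Fintype.ofEquiv _ e.symm
  let face : V → {S // IsZeroFace L S} := fun R => ⟨(e R).1, (e R).2.1⟩
  have hface : ∀ R, corank L (face R).1 = 2 := fun R => by
    have := (e R).2.2
    change corank L (face R).1 + (n - 1) = n + 1 at this
    omega
  have face_inj : Function.Injective face := fun R R' h =>
    e.injective (Subtype.ext (congrArg (fun S => S.1) h :))
  let Φ : {S // IsZeroFace L S} → {T // IsZeroFace L' T} := fun S => OrderDual.ofDual (Ψ S)
  let Φ' : {T // IsZeroFace L' T} → {S // IsZeroFace L S} := fun T => Ψ.symm (OrderDual.toDual T)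
  have hΦΦ' : ∀ T, Φ (Φ' T) = T := fun T => Ψ.apply_symm_apply _
  have hΦ'Φ : ∀ S, Φ' (Φ S) = S := fun S => Ψ.symm_apply_apply _
  have Φ_le : ∀ {S S'}, S ≤ S' → Φ S' ≤ Φ S := fun h => Ψ.monotone h
  have Φ_lt : ∀ {S S'}, S < S' → Φ S' < Φ S := fun h => Ψ.strictMono h
  have Φ'_lt : ∀ {T T'}, T < T' → Φ' T' < Φ' T := fun h =>
    Ψ.symm.strictMono (OrderDual.toDual_lt_toDual.2 h)
  let top : {S // IsZeroFace L S} := ⟨_, isZeroFace_univ⟩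
  have le_top : ∀ S, S ≤ top := fun S => Finset.subset_univ _
  have lt_top : ∀ {T}, T.1.Nonempty → Φ' T < top := by
    intro T hT
    refine lt_of_le_of_ne (le_top _) fun h => ?_
    have h0 : T ≤ ⟨∅, isZeroFace_empty _⟩ := by
      rw [← hΦΦ' T, h, ← hΦΦ' ⟨∅, isZeroFace_empty _⟩]
      exact Φ_le (le_top _)
    exact hT.ne_empty (Finset.subset_empty.1 h0)
  have Φ_nonempty : ∀ {S}, S < top → (Φ S).1.Nonempty := fun h =>
    Finset.card_pos.1 ((Nat.zero_le _).trans_lt (Finset.card_lt_card (Φ_lt h)))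
  -- the vertical edges
  let vert : Fin (n + 1) → Finset (Fin (n + 1) × Bool) := fun i => {i} ×ˢ Finset.univ
  let D : Finset V := {R | ∃ i, (Φ (face R)).1 = vert i}
  -- There are `n + 1` vertical edges and each is dual to at most one ridge; only this upper bound
  -- is needed.
  have hD : D.card < n + 2 := by
    have h1 : D.image (fun R => (Φ (face R)).1) ⊆ Finset.univ.image vert := by
      intro T hT
      obtain ⟨R, hR, rfl⟩ := Finset.mem_image.1 hT
      obtain ⟨i, hi⟩ := (Finset.mem_filter.1 hR).2
      exact Finset.mem_image.2 ⟨i, Finset.mem_univ i, hi.symm⟩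
    have h2 := (Finset.card_le_card h1).trans Finset.card_image_le
    rw [Finset.card_image_of_injective _ fun R R' h => face_inj
      (by rw [← hΦ'Φ (face R), Subtype.ext (a1 := Φ (face R)) h, hΦ'Φ])] at h2
    simp only [Finset.card_univ, Fintype.card_fin] at h2
    omega
  -- every other ridge is dual to an edge in one of the bases
  have hlevel : ∀ R : V, R ∉ D → ∃ b, ∀ v ∈ (Φ (face R)).1, v.2 = b := by
    intro R hR
    by_contra! hcon
    obtain ⟨v, hv, hv2⟩ := hcon true
    obtain ⟨w, hw, hw2⟩ := hcon false
    replace hv2 := Bool.eq_false_iff.2 hv2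
    replace hw2 := Bool.eq_true_of_not_eq_false hw2
    have hsub := exists_vertical_subset hu (Φ (face R)).2 hv hw hv2 hw2
    have hne : vert v.1 ≠ (Φ (face R)).1 := fun h => hR (by simp [D, ← h])
    let e₁ : {T // IsZeroFace L' T} := ⟨vert v.1, isZeroFace_prism_product_univ hu _⟩
    let e₂ : {T // IsZeroFace L' T} :=
      ⟨{v.1} ×ˢ {false}, isZeroFace_prism_product_singleton hu _ _⟩
    have h1 : e₁ < Φ (face R) := (Finset.ssubset_iff_subset_ne.2 ⟨hsub, hne⟩)
    have h2 : e₂ < e₁ := by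
      refine ((Finset.ssubset_iff_of_subset fun x hx => ?_).2
        ⟨(v.1, true), by simp [e₁, vert], by simp [e₂]⟩)
      simp only [e₁, e₂, vert, Finset.mem_product, Finset.mem_univ, and_true] at hx ⊢
      exact hx.1
    -- A face properly containing a vertical edge, that edge, and an endpoint of it dualise to a
    -- chain too long above a ridge.
    refine not_chain_of_corank_two (hface R) ?_ (Φ'_lt h2) (lt_top ⟨(v.1, false), by simp [e₂]⟩)
    rw [← hΦ'Φ (face R)]
    exact Φ'_lt h1
  -- one edge in each base
  let edge : Bool → {T // IsZeroFace L' T} := fun b =>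
    ⟨{0, Fin.last n} ×ˢ {b}, isZeroFace_prism_product_singleton hu _ _⟩
  have h0n : (0 : Fin (n + 1)) ≠ Fin.last n := by
    rw [Ne, Fin.ext_iff]
    simp only [Fin.val_zero, Fin.val_last]
    omega
  have hedge : ∀ b, corank L (Φ' (edge b)).1 = 2 := by
    intro b
    refine le_antisymm ?_ ?_
    -- Corank above two would give two successive proper nonempty subfaces below an edge having only
    -- two vertices.
    · by_contra! hcon
      obtain ⟨x, y, h1, h2, h3⟩ := exists_chain_of_two_lt_corank hcon
      have h1 := Finset.card_lt_card (Φ_lt h1)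
      have h2 := Finset.card_lt_card (Φ_lt h2)
      have h3 := (Φ_nonempty h3).card_pos
      rw [hΦΦ'] at h1
      have h4 : (edge b).1.card = 2 := by
        simp only [edge, Finset.card_product, Finset.card_pair h0n, Finset.card_singleton]
      omega
    · let x : {T // IsZeroFace L' T} := ⟨{0} ×ˢ {b}, isZeroFace_prism_product_singleton hu _ _⟩
      have h1 : x < edge b := by
        refine ((Finset.ssubset_iff_of_subset ?_).2
          ⟨(Fin.last n, b), by simp [edge], by simpa [x] using h0n.symm⟩)
        exact Finset.product_subset_product_left (by simp)
      have h2 := (Φ' (edge b)).2.corank_lt (Φ'_lt h1)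
      have h3 := (Φ' x).2.corank_lt ((lt_top (T := x) ⟨(0, b), by simp [x]⟩))
      omega
  let ridge : Bool → V := fun b => e.symm ⟨(Φ' (edge b)).1, (Φ' (edge b)).2, by
    have := hedge b
    change corank L (Φ' (edge b)).1 + (n - 1) = n + 1
    omega⟩
  have hridge : ∀ b, Φ (face (ridge b)) = edge b := by
    intro b
    have : face (ridge b) = Φ' (edge b) := Subtype.ext (by simp [face, ridge])
    rw [this, hΦΦ']
  have hridgeD : ∀ b, ridge b ∉ D := by
    intro b h
    obtain ⟨i, hi⟩ := (Finset.mem_filter.1 h).2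
    rw [hridge] at hi
    have : (i, !b) ∈ (edge b).1 := by simp [hi, vert]
    simp [edge] at this
  rintro ⟨-, hconn⟩
  -- Adjacent ridges lie in a common facet, whose dual face is nonempty; a vertex of it belongs to
  -- both dual edges, so the base cannot change along a walk.
  have hinv : ∀ {C C' : ((D : Set V)ᶜ : Set V)},
      ((faceGraph (convexHull ℝ (Set.range p)) (n - 1)).induce ((D : Set V)ᶜ)).Walk C C' →
      (∀ v ∈ (Φ (face C.1)).1, v.2 = true) → ∀ v ∈ (Φ (face C'.1)).1, v.2 = true := by
    intro C C' w
    induction w with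
    | nil => exact id
    | @cons C₁ C₂ C₃ hadj _ ih =>
      intro h
      refine ih ?_
      obtain ⟨-, H, hH, hHc, h1, h2⟩ := (faceGraph_adj_iff hd).1 hadj
      have hHt : (⟨H, hH⟩ : {S // IsZeroFace L S}) < top := by
        refine (Finset.ssubset_univ_iff.2 ?_)
        rintro rfl
        rw [corank_univ] at hHc
        omega
      obtain ⟨v, hv⟩ := Φ_nonempty hHt
      have hv1 : v ∈ (Φ (face C₁.1)).1 := Φ_le (S' := ⟨H, hH⟩) h1 hv
      have hv2 : v ∈ (Φ (face C₂.1)).1 := Φ_le (S' := ⟨H, hH⟩) h2 hv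
      obtain ⟨b, hb⟩ := hlevel C₂.1 C₂.2
      have : b = true := (hb v hv2).symm.trans (h v hv1)
      rwa [this] at hb
  obtain ⟨w⟩ := (hconn D hD).preconnected ⟨ridge true, hridgeD true⟩ ⟨ridge false, hridgeD false⟩
  have h := hinv w (by
    simp only [hridge]
    intro v hv
    simpa using (Finset.mem_product.1 hv).2) (0, false) (by simp [hridge, edge])
  simp at h

end DualOfPrism

/-! ### Anti-isomorphic face lattices from transposed incidence relations. -/

section Slack

variable {ι κ : Type*} [Fintype ι] [Fintype κ]

/-- The relation `rel` is the incidence relation of points (indexed by `ι`) with a family of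
supporting hyperplanes (indexed by `κ`) that separate every zero face from every other point. -/
def IsIncidence (L : Submodule ℝ (ι → ℝ)) (rel : ι → κ → Prop) : Prop :=
  (∀ k, ∃ f ∈ L, (∀ i, 0 ≤ f i) ∧ ∀ i, f i = 0 ↔ rel i k) ∧
    ∀ f ∈ L, (∀ i, 0 ≤ f i) → ∀ i, f i ≠ 0 → ∃ k, ¬ rel i k ∧ ∀ j, f j = 0 → rel j k

open Classical in
/-- The elements related to all elements of `S`. -/
noncomputable def polarSet (rel : ι → κ → Prop) (S : Finset ι) : Finset κ := {k | ∀ i ∈ S, rel i k}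

@[simp] theorem mem_polarSet {rel : ι → κ → Prop} {S : Finset ι} {k : κ} :
    k ∈ polarSet rel S ↔ ∀ i ∈ S, rel i k := by
  simp [polarSet]

theorem polarSet_anti {rel : ι → κ → Prop} {S T : Finset ι} (h : S ⊆ T) :
    polarSet rel T ⊆ polarSet rel S := fun _ hk =>
  mem_polarSet.2 fun i hi => mem_polarSet.1 hk i (h hi)

variable {L : Submodule ℝ (ι → ℝ)} {L' : Submodule ℝ (κ → ℝ)} {rel : ι → κ → Prop}

theorem IsIncidence.isZeroFace_polarSet (h : IsIncidence L rel) (K : Finset κ) :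
    IsZeroFace L (polarSet (fun k i => rel i k) K) := by
  choose f hf f0 fz using h.1
  refine ⟨∑ k ∈ K, f k, L.sum_mem fun k _ => hf k, fun i => ?_, fun i => ?_⟩
  · rw [Finset.sum_apply]
    exact Finset.sum_nonneg fun k _ => f0 k i
  · rw [Finset.sum_apply, Finset.sum_eq_zero_iff_of_nonneg fun k _ => f0 k i, mem_polarSet]
    exact forall₂_congr fun k _ => fz k i

/-- Faces are closed sets of the Galois connection of `rel`: a point outside a face is cut off by
one of the given hyperplanes containing the face. -/
theorem IsIncidence.polarSet_polarSet (h : IsIncidence L rel) {S : Finset ι}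
    (hS : IsZeroFace L S) : polarSet (fun k i => rel i k) (polarSet rel S) = S := by
  obtain ⟨f, hf, f0, fz⟩ := hS
  ext i
  simp only [mem_polarSet]
  refine ⟨fun hi => ?_, fun hi k hk => hk i hi⟩
  by_contra hiS
  obtain ⟨k, hk, hk'⟩ := h.2 f hf f0 i fun e => hiS ((fz i).1 e)
  exact hk (hi k fun j hj => hk' j ((fz j).2 hj))

/-- Configurations with transposed incidence relations have anti-isomorphic lattices of faces. -/
noncomputable def IsIncidence.polarEquiv (h : IsIncidence L rel)
    (h' : IsIncidence L' fun k i => rel i k) :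
    {S // IsZeroFace L S} ≃o {T // IsZeroFace L' T}ᵒᵈ where
  toFun S := OrderDual.toDual ⟨polarSet rel S.1, h'.isZeroFace_polarSet S.1⟩
  invFun T := ⟨polarSet (fun k i => rel i k) (OrderDual.ofDual T).1, h.isZeroFace_polarSet _⟩
  left_inv S := Subtype.ext (h.polarSet_polarSet S.2)
  right_inv T := Subtype.ext (h'.polarSet_polarSet (OrderDual.ofDual T).2)
  map_rel_iff' := by
    rintro ⟨S, hS⟩ ⟨T, hT⟩
    refine ⟨fun hST => ?_, fun hST => polarSet_anti hST⟩
    have := polarSet_anti (rel := fun k i => rel i k) hST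
    change polarSet (fun k i => rel i k) (polarSet rel S) ⊆
      polarSet (fun k i => rel i k) (polarSet rel T) at this
    rwa [h.polarSet_polarSet hS, h.polarSet_polarSet hT] at this

end Slack

/-! ### The bipyramid over a simplex as a dual of the prism. -/

section Bipyramid

/-- A vertex of the prism lies on a facet: a lateral facet or a base. -/
def prismIncidence {n : ℕ} (v : Fin (n + 1) × Bool) : Fin (n + 1) ⊕ Bool → Prop :=
  Sum.elim (fun j => v.1 ≠ j) (fun b => v.2 = b)

theorem isIncidence_prism {E : Type*} [NormedAddCommGroup E] [NormedSpace ℝ E] {n : ℕ}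
    {Δ : Affine.Simplex ℝ E n} {u : E}
    (hu : u ∉ (affineSpan ℝ (Set.range Δ.points)).direction) :
    IsIncidence (affineFunctions (prismPoint Δ u)) prismIncidence := by
  constructor
  · rintro (j | b)
    · obtain ⟨f, hf, f0, fz⟩ := isZeroFace_prism_product_univ hu {j}ᶜ
      exact ⟨f, hf, f0, fun v => by simp [fz, prismIncidence]⟩
    · obtain ⟨f, hf, f0, fz⟩ := isZeroFace_prism_product_singleton hu Finset.univ b
      exact ⟨f, hf, f0, fun v => by
        rw [fz, Finset.mem_product, Finset.mem_singleton]
        simp [prismIncidence]⟩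
  · rintro f hf f0 ⟨i, b⟩ hi
    obtain ⟨a, c, rfl⟩ := (mem_affineFunctions_prismPoint hu).1 hf
    have ha0 : ∀ j, 0 ≤ a j := fun j => by simpa using f0 (j, false)
    have hac : ∀ j, 0 ≤ a j + c := fun j => by simpa using f0 (j, true)
    -- This asks whether the function vanishes at the other end of the vertical edge over `i`. If
    -- so, it increases from level `!b` to level `b`, hence is positive on all of level `b`, and the
    -- base `!b` contains its zeros. If not, the lateral facet opposite `i` does.
    by_cases hi' : a i + (if !b then c else 0) = 0
    · refine ⟨Sum.inr (!b), by simp [prismIncidence], ?_⟩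
      rintro ⟨j, b'⟩ hj
      have h1 := ha0 j
      have h2 := hac j
      have h3 := ha0 i
      have h4 := hac i
      by_contra hb
      have hb' : b' = b := by
        simpa [prismIncidence] using hb
      subst hb'
      cases b'
      · simp only [Bool.not_false, if_true, Bool.false_eq_true, if_false, add_zero] at hi hi' hj
        exact hi (by linarith)
      · simp only [Bool.not_true, if_true, Bool.false_eq_true, if_false, add_zero] at hi hi' hj
        exact hi (by linarith)
    · refine ⟨Sum.inl i, by simp [prismIncidence], ?_⟩
      rintro ⟨j, b'⟩ hj
      simp only [prismIncidence, Sum.elim_inl]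
      rintro rfl
      cases b <;> cases b' <;> simp_all

/-- The vertices of a bipyramid over a simplex: the standard basis vectors, the origin and twice
the barycentre of the basis vectors. -/
noncomputable def bipyramidPoint (n : ℕ) :
    Fin (n + 1) ⊕ Bool → EuclideanSpace ℝ (Fin (n + 1)) :=
  Sum.elim (EuclideanSpace.basisFun (Fin (n + 1)) ℝ).toBasis
    (fun b => if b then (2 / ((n : ℝ) + 1)) •
      ∑ j, (EuclideanSpace.basisFun (Fin (n + 1)) ℝ).toBasis j else 0)

/-- The only affine dependence among the vertices says that the midpoint of the apices is the
barycentre of the basis vectors. -/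
theorem mem_affineFunctions_bipyramidPoint {n : ℕ} {g : Fin (n + 1) ⊕ Bool → ℝ} :
    g ∈ affineFunctions (bipyramidPoint n) ↔
      2 * ∑ j, g (Sum.inl j) = (n + 1) * (g (Sum.inr false) + g (Sum.inr true)) := by
  have hn : (n : ℝ) + 1 ≠ 0 := by positivity
  constructor
  · rintro ⟨⟨f, α⟩, rfl⟩
    simp only [affineEval_apply, bipyramidPoint, Sum.elim_inl, Sum.elim_inr, if_true,
      Bool.false_eq_true, if_false, map_zero, map_smul, map_sum, Finset.sum_add_distrib,
      Finset.sum_const, Finset.card_univ, Fintype.card_fin, nsmul_eq_mul, smul_eq_mul]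
    push_cast
    field_simp
    ring
  · intro hg
    refine ⟨((EuclideanSpace.basisFun (Fin (n + 1)) ℝ).toBasis.constr ℝ
      (fun j => g (Sum.inl j) - g (Sum.inr false)), g (Sum.inr false)), ?_⟩
    ext (j | b)
    · simp only [affineEval_apply, bipyramidPoint, Sum.elim_inl, Module.Basis.constr_basis]
      ring
    · cases b
      · simp [bipyramidPoint]
      · simp only [affineEval_apply, bipyramidPoint, Sum.elim_inr, if_true, map_smul, map_sum,
          Module.Basis.constr_basis, Finset.sum_sub_distrib, Finset.sum_const, Finset.card_univ,
          Fintype.card_fin, nsmul_eq_mul, smul_eq_mul]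
        push_cast
        field_simp
        linarith

theorem isIncidence_bipyramid (n : ℕ) :
    IsIncidence (affineFunctions (bipyramidPoint n)) fun k v => prismIncidence v k := by
  have hn : (0 : ℝ) < n + 1 := by positivity
  constructor
  · rintro ⟨i, b⟩
    -- The facet `(i, b)` misses only the basis vector `i` and the apex `!b`; the value `2 / (n +
    -- 1)` there balances the affine dependence.
    refine ⟨Sum.elim (fun j => if j = i then 1 else 0)
      (fun b' => if b' = b then 0 else 2 / ((n : ℝ) + 1)),
      mem_affineFunctions_bipyramidPoint.2 ?_, ?_, ?_⟩
    · cases b <;> simp <;> field_simp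
    · rintro (j | b') <;> simp only [Sum.elim_inl, Sum.elim_inr] <;> split_ifs <;> positivity
    · rintro (j | b')
      · simp [prismIncidence, eq_comm]
      · by_cases h : b' = b
        · simp [prismIncidence, h]
        · simpa [prismIncidence, h, Ne.symm h] using hn.ne'
  · rintro f hf f0 k hk
    have hsum := mem_affineFunctions_bipyramidPoint.1 hf
    rcases k with j | b
    · have hpos : 0 < ∑ j, f (Sum.inl j) :=
        Finset.sum_pos' (fun j _ => f0 _) ⟨j, Finset.mem_univ j, lt_of_le_of_ne (f0 _) hk.symm⟩
      -- By the affine dependence, a nonnegative function that is positive at a basis vector is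
      -- positive at some apex, and conversely. The facet omitting exactly these two vertices
      -- contains all zeros.
      obtain ⟨b, hb⟩ : ∃ b, f (Sum.inr b) ≠ 0 := by
        by_contra! hcon
        rw [hcon, hcon] at hsum
        linarith
      refine ⟨(j, !b), by simp [prismIncidence], ?_⟩
      rintro (j' | b') h
      · simp only [prismIncidence, Sum.elim_inl]
        rintro rfl
        exact hk h
      · simp only [prismIncidence, Sum.elim_inr]
        have : b' ≠ b := by rintro rfl; exact hb h
        cases b <;> cases b' <;> simp_all
    · obtain ⟨j, hj⟩ : ∃ j, f (Sum.inl j) ≠ 0 := by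
        by_contra! hcon
        simp only [hcon, Finset.sum_const_zero, mul_zero, zero_eq_mul, hn.ne', false_or] at hsum
        rw [add_eq_zero_iff_of_nonneg (f0 _) (f0 _)] at hsum
        cases b
        · exact hk hsum.1
        · exact hk hsum.2
      refine ⟨(j, !b), by simp [prismIncidence], ?_⟩
      rintro (j' | b') h
      · simp only [prismIncidence, Sum.elim_inl]
        rintro rfl
        exact hj h
      · simp only [prismIncidence, Sum.elim_inr]
        have : b' ≠ b := by rintro rfl; exact hk h
        cases b <;> cases b' <;> simp_all

theorem hasAffineDim_bipyramid (n : ℕ) :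
    HasAffineDim (convexHull ℝ (Set.range (bipyramidPoint n))) (n + 1) := by
  refine ⟨convexHull_nonempty_iff.2 (Set.range_nonempty _), ?_⟩
  have : vectorSpan ℝ (Set.range (bipyramidPoint n)) = ⊤ := by
    rw [eq_top_iff, ← (EuclideanSpace.basisFun (Fin (n + 1)) ℝ).toBasis.span_eq,
      Submodule.span_le]
    rintro _ ⟨j, rfl⟩
    have := vsub_mem_vectorSpan ℝ (Set.mem_range_self (f := bipyramidPoint n) (Sum.inl j))
      (Set.mem_range_self (f := bipyramidPoint n) (Sum.inr false))
    simpa [bipyramidPoint] using this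
  rw [finrank_direction_convexHull, this, finrank_top, finrank_euclideanSpace, Fintype.card_fin]

/-- The simplex spanned by the standard basis vectors. -/
noncomputable def basisSimplex (n : ℕ) : Affine.Simplex ℝ (EuclideanSpace ℝ (Fin (n + 1))) n where
  points := (EuclideanSpace.basisFun (Fin (n + 1)) ℝ).toBasis
  independent := (EuclideanSpace.basisFun (Fin (n + 1)) ℝ).toBasis.linearIndependent.affineIndependent

theorem sum_basis_notMem_direction (n : ℕ) :
    ∑ j, (EuclideanSpace.basisFun (Fin (n + 1)) ℝ).toBasis j ∉
      (affineSpan ℝ (Set.range (basisSimplex n).points)).direction := by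
  set B := (EuclideanSpace.basisFun (Fin (n + 1)) ℝ).toBasis
  intro h
  rw [direction_affineSpan, vectorSpan_def] at h
  -- The coordinate sum vanishes on differences of basis vectors but equals `n + 1` on their sum.
  have hle : Submodule.span ℝ (Set.range (basisSimplex n).points -ᵥ
      Set.range (basisSimplex n).points) ≤ LinearMap.ker (B.constr ℝ fun _ => (1 : ℝ)) := by
    rw [Submodule.span_le]
    rintro _ ⟨_, ⟨i, rfl⟩, _, ⟨j, rfl⟩, rfl⟩
    change B.constr ℝ (fun _ => (1 : ℝ)) (B i - B j) = 0
    rw [map_sub, Module.Basis.constr_basis, Module.Basis.constr_basis, sub_self]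
  have := LinearMap.mem_ker.1 (hle h)
  simp only [map_sum, Module.Basis.constr_basis, Finset.sum_const, Finset.card_univ,
    Fintype.card_fin, nsmul_eq_mul, mul_one] at this
  norm_cast at this

end Bipyramid

theorem proposition3p1 (d : ℕ) (hd : 2 ≤ d) :
    (∀ (N : ℕ) (P : Set (EuclideanSpace ℝ (Fin N))),
      IsConvexPolytope P → HasAffineDim P d → IsVertexConnected (faceGraph P (d - 2)) d) ∧
    (∃ (N : ℕ) (P : Set (EuclideanSpace ℝ (Fin N))),
      IsConvexPolytope P ∧ HasAffineDim P d ∧ IsDualOfSimplexPrism P (d - 1)) ∧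
    (∀ (N : ℕ) (P : Set (EuclideanSpace ℝ (Fin N))),
      IsConvexPolytope P → HasAffineDim P d → IsDualOfSimplexPrism P (d - 1) →
        ¬ IsVertexConnected (faceGraph P (d - 2)) (d + 1)) := by
  refine ⟨fun N P hP hPd => ?_, ?_, fun N P hP hPd hQ => ?_⟩
  · obtain ⟨m, p, rfl⟩ := hP.exists_family
    exact isVertexConnected_faceGraph hd hPd
  · obtain ⟨n, rfl⟩ : ∃ n, d = n + 1 := ⟨d - 1, by omega⟩
    refine ⟨n + 1, convexHull ℝ (Set.range (bipyramidPoint n)),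
      ⟨_, Set.finite_range _, rfl⟩, hasAffineDim_bipyramid n, n + 1, _,
      ⟨basisSimplex n, _, sum_basis_notMem_direction n, rfl⟩, ?_⟩
    rw [← convexHull_range_prismPoint]
    exact ⟨(faceLatticeEquiv _).trans (((isIncidence_bipyramid n).polarEquiv
      (isIncidence_prism (sum_basis_notMem_direction n))).trans (faceLatticeEquiv _).symm.dual)⟩
  · obtain ⟨n, rfl⟩ : ∃ n, d = n + 1 := ⟨d - 1, by omega⟩
    obtain ⟨m, p, rfl⟩ := hP.exists_family
    obtain ⟨M, _, ⟨Δ, u, hu, rfl⟩, hΨ⟩ := hQ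
    rw [← convexHull_range_prismPoint] at hΨ
    obtain ⟨Ψ⟩ := hΨ
    exact not_isVertexConnected_faceGraph_of_dual_prism (n := n) (by omega) hPd hu
      ((faceLatticeEquiv p).symm.trans (Ψ.trans (faceLatticeEquiv _).dual))
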